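/- Let $\Lambda$ be an artin algebra (a ring that is an algebra over, and a finitely generated module over, some commutative artinian ring), let $\mathrm{mod}\,\Lambda$ be the category of finitely generated left $\Lambda$-modules, let $P$ be a finitely generated projective $\Lambda$-module, and let $\Gamma=\mathrm{End}_\Lambda(P)^{op}$. For $M$ in $\mathrm{mod}\,\Lambda$, $\mathrm{Hom}_\Lambda(P,M)$ is a finitely generated left $\Gamma$-module by precomposition, and $\Gamma$ is again an artin algebra. The following notions are used for both algebras. For a module $M$, $\mathrm{add}\,M$ is the class of direct summands of finite direct sums of copies of $M$. For $d\in\mathbb N=\{0,1,2,\dots\}$, a pair $(X_1,X_2)$ of modules in $\mathrm{add}\,M$ is a *$d$-division* of $M$ if $\mathrm{add}\,X_1\cap\mathrm{add}\,X_2=0$, $\mathrm{Ext}^d_\Lambda(X_1,-)\not\simeq\mathrm{Ext}^d_\Lambda(X_2,-)$ and $\mathrm{Ext}^{d+1}_\Lambda(X_1,-)\simeq\mathrm{Ext}^{d+1}_\Lambda(X_2,-)$ as functors on $\mathrm{mod}\,\Lambda$. Let $\Omega(M)$ be the kernel of the projective cover of $M$. Let $K_0$ be the abelian group generated by the symbols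 $[M]$, $M$ in $\mathrm{mod}\,\Lambda$, modulo $[C]=[A]+[B]$ if $C\simeq A\oplus B$ and $[Q]=0$ if $Q$ is projective; write $\Omega:K_0\to K_0$ also for the endomorphism $[M]\mapsto[\Omega(M)]$, and $\langle\mathrm{add}\,M\rangle\subseteq K_0$ for the subgroup generated by the classes of the indecomposable direct summands of $M$. Then $\phi_l^\Lambda(M)$ is the smallest integer $n\ge 0$ such that $\Omega:\Omega^s(\langle\mathrm{add}\,M\rangle)\to\Omega^{s+1}(\langle\mathrm{add}\,M\rangle)$ is an isomorphism for all $s\ge n$, and $$\psi_l^\Lambda(M)=\phi_l^\Lambda(M)+\sup\{\mathrm{pd}\,X : X \text{ a nonzero direct summand of } \Omega^{\phi_l^\Lambda(M)}(M),\ \mathrm{pd}\,X<\infty\},$$ with $\sup\emptyset=0$. Let $Y$ be in $\mathrm{mod}\,\Lambda$ and suppose that $Y$ has a projective resolution $\cdots\to P_1\to P_0\to Y\to 0$ with $P_i\in\mathrm{add}\,P$ for all $i\ge 0$ (that is, $Y\in\mathbb P_\infty$). Then: (a) for every $d\in\mathbb N$, there is a $d$-division of $Y$ if and only if there is a $d$-division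 of the $\Gamma$-module $\mathrm{Hom}_\Lambda(P,Y)$; (b) $\phi_l^\Lambda(Y)=\phi_l^\Gamma(\mathrm{Hom}_\Lambda(P,Y))$; (c) $\psi_l^\Lambda(Y)=\psi_l^\Gamma(\mathrm{Hom}_\Lambda(P,Y))$. -/

import Mathlib

open CategoryTheory

universe u

namespace IgusaTodorov

noncomputable section

/-- An artin algebra: a ring that is a finitely generated module over some commutative artinian
ring `R` by which it is an algebra. -/
class IsArtinAlgebra (Λ : Type u) [Ring Λ] : Prop where
  exists_base : ∃ (R : Type u) (_ : CommRing R) (_ : IsArtinianRing R) (_ : Algebra R Λ),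
    Module.Finite R Λ

instance IsArtinAlgebra.isArtinianRing (Λ : Type u) [Ring Λ] [h : IsArtinAlgebra Λ] :
    IsArtinianRing Λ := by
  obtain ⟨R, _, _, _, _⟩ := h.exists_base
  exact isArtinian_of_tower R inferInstance

section Modules

variable {Λ : Type u} [Ring Λ]

/-- `X` is (isomorphic to) a direct summand of `M`. -/
def IsSummand (X M : Type u) [AddCommGroup X] [Module Λ X] [AddCommGroup M] [Module Λ M] : Prop :=
  ∃ (i : X →ₗ[Λ] M) (p : M →ₗ[Λ] X), p ∘ₗ i = LinearMap.id

/-- `X` belongs to `add M`: it is a direct summand of a finite direct sum of copies of `M`. -/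
def InAdd (M X : Type u) [AddCommGroup M] [Module Λ M] [AddCommGroup X] [Module Λ X] : Prop :=
  ∃ n : ℕ, IsSummand (Λ := Λ) X (Fin n → M)

/-- A nonzero module which is not the direct sum of two nonzero submodules. -/
def IsIndecomposable (X : Type u) [AddCommGroup X] [Module Λ X] : Prop :=
  Nontrivial X ∧ ∀ A B : Submodule Λ X, IsCompl A B → A = ⊥ ∨ B = ⊥

/-- `f : Q → M` is a projective cover: `Q` is projective, `f` is surjective, and the kernel of `f`
is superfluous. -/
structure IsProjectiveCover {Q M : Type u} [AddCommGroup Q] [Module Λ Q]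
    [AddCommGroup M] [Module Λ M] (f : Q →ₗ[Λ] M) : Prop where
  projective : Module.Projective Λ Q
  surjective : Function.Surjective f
  superfluous : ∀ N : Submodule Λ Q, N ⊔ LinearMap.ker f = ⊤ → N = ⊤

/-- The functor `Ext^d_Λ(X, -)` on the category `mod Λ` of finitely generated modules. -/
def extFunctorMod (X : FGModuleCat.{u} Λ) (d : ℕ) : FGModuleCat.{u} Λ ⥤ AddCommGrpCat.{u} :=
  forget₂ (FGModuleCat.{u} Λ) (ModuleCat.{u} Λ) ⋙ Abelian.extFunctorObj X.obj d

/-- The pair `(X, Y)` is a `d`-division of `M`. -/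
structure IsDivision (d : ℕ) (M X Y : FGModuleCat.{u} Λ) : Prop where
  left_mem : InAdd (Λ := Λ) M X
  right_mem : InAdd (Λ := Λ) M Y
  add_inter : ∀ Z : FGModuleCat.{u} Λ, InAdd (Λ := Λ) X Z → InAdd (Λ := Λ) Y Z → Subsingleton Z
  not_iso : ¬ Nonempty (extFunctorMod X d ≅ extFunctorMod Y d)
  iso_succ : Nonempty (extFunctorMod X (d + 1) ≅ extFunctorMod Y (d + 1))

/-- `M` has a `d`-division. -/
def HasDivision (d : ℕ) (M : FGModuleCat.{u} Λ) : Prop :=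
  ∃ X Y : FGModuleCat.{u} Λ, IsDivision d M X Y

/-- `Y ∈ ℙ_∞`: `Y` has a projective resolution all of whose terms are in `add P`. -/
def HasAddResolution (P : Type u) [AddCommGroup P] [Module Λ P] (Y : FGModuleCat.{u} Λ) : Prop :=
  ∃ Q : ProjectiveResolution Y.obj, ∀ i : ℕ, InAdd (Λ := Λ) P (Q.complex.X i)

end Modules

section Syzygy

variable {Λ : Type u} [Ring Λ] [IsArtinianRing Λ]

/-- Over an artinian ring every finitely generated module has a projective cover. -/
theorem exists_projectiveCover (M : FGModuleCat.{u} Λ) :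
    ∃ (Q : FGModuleCat.{u} Λ) (f : Q →ₗ[Λ] M), IsProjectiveCover f := by
  classical
  let S : Set ℕ := {l | ∃ (Q : FGModuleCat.{u} Λ) (f : Q →ₗ[Λ] M), Module.Projective Λ Q ∧
    Function.Surjective f ∧ Module.length Λ Q = l}
  have hlen : ∀ Q : FGModuleCat.{u} Λ, ∃ l : ℕ, Module.length Λ Q = l := fun Q ↦
    ⟨_, (ENat.natCast_toNat (Module.length_ne_top (R := Λ) (M := Q))).symm⟩
  have hS : S.Nonempty := by
    obtain ⟨n, f, hf⟩ := Module.Finite.exists_fin' Λ M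
    obtain ⟨l, hl⟩ := hlen (FGModuleCat.of Λ (Fin n → Λ))
    exact ⟨l, FGModuleCat.of Λ (Fin n → Λ), f,
      inferInstanceAs (Module.Projective Λ (Fin n → Λ)), hf, hl⟩
  obtain ⟨Q, f, hQ, hf, hl⟩ := Nat.sInf_mem hS
  refine ⟨Q, f, hQ, hf, fun N hN ↦ ?_⟩
  by_contra hNtop
  have hfN : Function.Surjective (f ∘ₗ N.subtype) := by
    intro m
    obtain ⟨q, rfl⟩ := hf m
    have hq : q ∈ N ⊔ LinearMap.ker f := hN ▸ Submodule.mem_top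
    obtain ⟨x, hx, k, hk, rfl⟩ := Submodule.mem_sup.1 hq
    exact ⟨⟨x, hx⟩, by simp [LinearMap.mem_ker.1 hk]⟩
  obtain ⟨g, hg⟩ := Module.projective_lifting_property (f ∘ₗ N.subtype) f hfN
  let h : Module.End Λ Q := N.subtype ∘ₗ g
  have hh : ∀ q, f (h q) = f q := fun q ↦ LinearMap.congr_fun hg q
  have hpow : ∀ n q, f ((h ^ n) q) = f q := by
    intro n
    induction n with
    | zero => intro q; rfl
    | succ n ih => intro q; rw [pow_succ, Module.End.mul_apply, ih, hh]
  obtain ⟨n, hn⟩ := Filter.eventually_atTop.1 h.eventually_isCompl_ker_pow_range_pow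
  have hc := hn (n + 1) (Nat.le_succ n)
  set I := LinearMap.range (h ^ (n + 1)) with hI
  have hIN : I ≤ N := by
    rintro _ ⟨q, rfl⟩
    rw [pow_succ', Module.End.mul_apply]
    exact (g _).2
  have hItop : I < ⊤ := lt_of_le_of_lt hIN (lt_top_iff_ne_top.2 hNtop)
  have hproj : Module.Projective Λ I :=
    Module.Projective.of_split I.subtype (Submodule.projectionOnto I _ hc.symm)
      (LinearMap.ext fun x ↦ Submodule.projectionOnto_apply_left hc.symm x)
  have hsurj : Function.Surjective (f ∘ₗ I.subtype) := by
    intro m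
    obtain ⟨q, rfl⟩ := hf m
    exact ⟨⟨(h ^ (n + 1)) q, q, rfl⟩, hpow (n + 1) q⟩
  obtain ⟨l, hl'⟩ := hlen (FGModuleCat.of Λ I)
  have h1 : sInf S ≤ l := Nat.sInf_le ⟨FGModuleCat.of Λ I, f ∘ₗ I.subtype, hproj, hsurj, hl'⟩
  have h2 : Module.length Λ I < Module.length Λ Q := Submodule.length_lt hItop.ne
  have h3 : (l : ℕ∞) < (sInf S : ℕ) := by rw [← hl', ← hl]; exact h2
  exact absurd h1 (not_le.2 (by exact_mod_cast h3))

/-- The projective cover `P_0(M)`. -/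
def coverObj (M : FGModuleCat.{u} Λ) : FGModuleCat.{u} Λ :=
  (exists_projectiveCover M).choose

/-- The projective cover map `P_0(M) → M`. -/
def coverMap (M : FGModuleCat.{u} Λ) : coverObj M →ₗ[Λ] M :=
  (exists_projectiveCover M).choose_spec.choose

theorem isProjectiveCover_coverMap (M : FGModuleCat.{u} Λ) : IsProjectiveCover (coverMap M) :=
  (exists_projectiveCover M).choose_spec.choose_spec

/-- The syzygy `Ω(M)`, the kernel of the projective cover of `M`. -/
def syzygy (M : FGModuleCat.{u} Λ) : FGModuleCat.{u} Λ :=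
  FGModuleCat.of Λ (LinearMap.ker (coverMap M))

/-- The iterated syzygy `Ω^n(M)`. -/
def syzygyIter (n : ℕ) (M : FGModuleCat.{u} Λ) : FGModuleCat.{u} Λ :=
  syzygy^[n] M

end Syzygy

section K0

variable (Λ : Type u) [Ring Λ]

/-- The defining relations of `K_0`: `[C] = [A] + [B]` if `C ≅ A ⊕ B`, and `[Q] = 0` if `Q` is
projective. -/
def k0Relations : Set (FreeAbelianGroup (FGModuleCat.{u} Λ)) :=
  {x | ∃ A B C : FGModuleCat.{u} Λ, Nonempty (C ≃ₗ[Λ] A × B) ∧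
      x = FreeAbelianGroup.of C - (FreeAbelianGroup.of A + FreeAbelianGroup.of B)} ∪
  {x | ∃ Q : FGModuleCat.{u} Λ, Module.Projective Λ Q ∧ x = FreeAbelianGroup.of Q}

/-- The abelian group generated by the symbols `[M]`, `M` in `mod Λ`, modulo the relations. -/
abbrev K0 : Type (u + 1) :=
  FreeAbelianGroup (FGModuleCat.{u} Λ) ⧸ AddSubgroup.closure (k0Relations Λ)

variable {Λ}

/-- The class `[M]` in `K_0`. -/
def K0.cls (M : FGModuleCat.{u} Λ) : K0 Λ :=
  QuotientAddGroup.mk (FreeAbelianGroup.of M)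

theorem K0.cls_prod {A B C : FGModuleCat.{u} Λ} (e : C ≃ₗ[Λ] A × B) :
    K0.cls C = K0.cls A + K0.cls B := by
  have h := (QuotientAddGroup.eq_zero_iff _).2 (AddSubgroup.subset_closure
    (show _ ∈ k0Relations Λ from Or.inl ⟨A, B, C, ⟨e⟩, rfl⟩))
  rw [QuotientAddGroup.mk_sub, sub_eq_zero] at h
  exact h

theorem K0.cls_projective (Q : FGModuleCat.{u} Λ) (h : Module.Projective Λ Q) :
    K0.cls Q = 0 :=
  (QuotientAddGroup.eq_zero_iff _).2 (AddSubgroup.subset_closure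
    (show _ ∈ k0Relations Λ from Or.inr ⟨Q, h, rfl⟩))

/-- The subgroup `⟨add M⟩` of `K_0` generated by the indecomposable direct summands of `M`. -/
def addSpan (M : FGModuleCat.{u} Λ) : AddSubgroup (K0 Λ) :=
  AddSubgroup.closure {x | ∃ X : FGModuleCat.{u} Λ, IsSummand (Λ := Λ) X M ∧
    IsIndecomposable (Λ := Λ) X ∧ x = K0.cls X}

end K0

section Omega

variable {Λ : Type u} [Ring Λ]

/-- One half of Schanuel's lemma: the pullback of two surjections `f`, `g` onto `M` is
`ker f × Q'` if `Q'` is projective. -/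
theorem exists_pullback_equiv {Q Q' M : Type u} [AddCommGroup Q] [Module Λ Q] [AddCommGroup Q']
    [Module Λ Q'] [AddCommGroup M] [Module Λ M] (f : Q →ₗ[Λ] M) (g : Q' →ₗ[Λ] M)
    (hf : Function.Surjective f) [Module.Projective Λ Q'] :
    Nonempty (LinearMap.eqLocus (f ∘ₗ LinearMap.fst Λ Q Q') (g ∘ₗ LinearMap.snd Λ Q Q') ≃ₗ[Λ]
      LinearMap.ker f × Q') := by
  obtain ⟨s, hs⟩ := Module.projective_lifting_property f g hf
  have hs' : ∀ q, f (s q) = g q := fun q ↦ LinearMap.congr_fun hs q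
  refine ⟨LinearEquiv.ofLinearMap
    (LinearMap.prod
      (LinearMap.codRestrict _ ((LinearMap.fst Λ Q Q' - s ∘ₗ LinearMap.snd Λ Q Q') ∘ₗ
        Submodule.subtype _) ?_)
      (LinearMap.snd Λ Q Q' ∘ₗ Submodule.subtype _))
    (LinearMap.codRestrict _
      (LinearMap.prod ((LinearMap.ker f).subtype ∘ₗ LinearMap.fst Λ _ _ + s ∘ₗ LinearMap.snd Λ _ _)
        (LinearMap.snd Λ _ _)) ?_) ?_ ?_⟩
  · rintro ⟨⟨a, b⟩, hab⟩
    have hab' : f a = g b := hab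
    simp [hs', hab']
  · rintro ⟨⟨k, hk⟩, b⟩
    have hk' : f k = 0 := hk
    simp [LinearMap.mem_eqLocus, hs', hk']
  · ext x <;> simp
  · ext x <;> simp

theorem K0.cls_ker_eq [IsArtinianRing Λ] {Q Q' M : FGModuleCat.{u} Λ} (f : Q →ₗ[Λ] M) (g : Q' →ₗ[Λ] M)
    (hf : Function.Surjective f) (hg : Function.Surjective g)
    (hQ : Module.Projective Λ Q) (hQ' : Module.Projective Λ Q') :
    K0.cls (FGModuleCat.of Λ (LinearMap.ker f)) = K0.cls (FGModuleCat.of Λ (LinearMap.ker g)) := by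
  obtain ⟨e₁⟩ := exists_pullback_equiv f g hf
  obtain ⟨e₂⟩ := exists_pullback_equiv g f hg
  let σ : LinearMap.eqLocus (f ∘ₗ LinearMap.fst Λ Q Q') (g ∘ₗ LinearMap.snd Λ Q Q') ≃ₗ[Λ]
      LinearMap.eqLocus (g ∘ₗ LinearMap.fst Λ Q' Q) (f ∘ₗ LinearMap.snd Λ Q' Q) :=
    LinearEquiv.ofLinearMap
      (LinearMap.codRestrict _ ((LinearEquiv.prodComm Λ Q Q').toLinearMap ∘ₗ Submodule.subtype _)
        (fun x ↦ x.2.symm))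
      (LinearMap.codRestrict _ ((LinearEquiv.prodComm Λ Q' Q).toLinearMap ∘ₗ Submodule.subtype _)
        (fun x ↦ x.2.symm))
      (by ext x <;> rfl) (by ext x <;> rfl)
  have h₁ := K0.cls_prod (C := FGModuleCat.of Λ (LinearMap.ker f × Q'))
    (A := FGModuleCat.of Λ (LinearMap.ker f)) (B := Q') (LinearEquiv.refl Λ _)
  have h₂ := K0.cls_prod (C := FGModuleCat.of Λ (LinearMap.ker f × Q'))
    (A := FGModuleCat.of Λ (LinearMap.ker g)) (B := Q) (e₁.symm ≪≫ₗ σ ≪≫ₗ e₂)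
  rw [K0.cls_projective Q' hQ', add_zero] at h₁
  rw [K0.cls_projective Q hQ, add_zero] at h₂
  exact h₁.symm.trans h₂

/-- The endomorphism `Ω` of `K_0` induced by the syzygy, `Ω([M]) = [Ω(M)]`. -/
def omega (Λ : Type u) [Ring Λ] [IsArtinianRing Λ] : K0 Λ →+ K0 Λ :=
  QuotientAddGroup.lift (AddSubgroup.closure (k0Relations Λ))
    (FreeAbelianGroup.lift fun M ↦ K0.cls (syzygy M)) <| by
    rw [AddSubgroup.closure_le]
    rintro x (⟨A, B, C, ⟨e⟩, rfl⟩ | ⟨Q, hQ, rfl⟩)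
    · have hA := isProjectiveCover_coverMap A
      have hB := isProjectiveCover_coverMap B
      have hC := isProjectiveCover_coverMap C
      let f := coverMap A
      let g := coverMap B
      let p : (FGModuleCat.of Λ (coverObj A × coverObj B)) →ₗ[Λ] C :=
        e.symm.toLinearMap ∘ₗ f.prodMap g
      have hp : Function.Surjective p :=
        e.symm.surjective.comp (hA.surjective.prodMap hB.surjective)
      have hpr : Module.Projective Λ (FGModuleCat.of Λ (coverObj A × coverObj B)) := by
        have := hA.projective
        have := hB.projective
        exact inferInstanceAs (Module.Projective Λ (coverObj A × coverObj B))
      have hmem : ∀ x : coverObj A × coverObj B,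
          x ∈ LinearMap.ker p ↔ x.1 ∈ LinearMap.ker f ∧ x.2 ∈ LinearMap.ker g := by
        intro x
        have : p x = e.symm (f x.1, g x.2) := rfl
        simp [LinearMap.mem_ker, this]
      have h := K0.cls_ker_eq p (coverMap C) hp hC.surjective hpr hC.projective
      have h' := K0.cls_prod (C := FGModuleCat.of Λ (LinearMap.ker p)) (A := syzygy A)
        (B := syzygy B)
        { toFun := fun x ↦ ⟨⟨x.1.1, (hmem x.1).1 x.2 |>.1⟩, ⟨x.1.2, (hmem x.1).1 x.2 |>.2⟩⟩
          invFun := fun y ↦ ⟨(y.1.1, y.2.1), (hmem _).2 ⟨y.1.2, y.2.2⟩⟩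
          map_add' := fun _ _ ↦ rfl
          map_smul' := fun _ _ ↦ rfl
          left_inv := fun _ ↦ rfl
          right_inv := fun _ ↦ rfl }
      have h'' : K0.cls (syzygy C) = K0.cls (syzygy A) + K0.cls (syzygy B) := h.symm.trans h'
      simp [h'']
    · have h := K0.cls_ker_eq (coverMap Q) (LinearMap.id : Q →ₗ[Λ] Q)
        (isProjectiveCover_coverMap Q).surjective Function.surjective_id
        (isProjectiveCover_coverMap Q).projective hQ
      have hz : K0.cls (FGModuleCat.of Λ (LinearMap.ker (LinearMap.id : Q →ₗ[Λ] Q))) = 0 := by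
        refine K0.cls_projective _ ?_
        have : Subsingleton (LinearMap.ker (LinearMap.id : Q →ₗ[Λ] Q)) := by
          rw [LinearMap.ker_id]; infer_instance
        exact inferInstanceAs (Module.Projective Λ (LinearMap.ker (LinearMap.id : Q →ₗ[Λ] Q)))
      have h' : K0.cls (syzygy Q) = 0 := h.trans hz
      simp [h']

variable [IsArtinianRing Λ]

theorem omega_cls (M : FGModuleCat.{u} Λ) : omega Λ (K0.cls M) = K0.cls (syzygy M) := by
  simp [omega, K0.cls]

/-- The subgroup `Ω^s(⟨add M⟩)` of `K_0`. -/
def omegaSpan (M : FGModuleCat.{u} Λ) (s : ℕ) : AddSubgroup (K0 Λ) :=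
  (AddSubgroup.map (omega Λ))^[s] (addSpan M)

/-- The Igusa-Todorov function `φ_l`: the smallest `n` such that
`Ω : Ω^s(⟨add M⟩) → Ω^(s+1)(⟨add M⟩)` is an isomorphism for all `s ≥ n`. -/
def phi (M : FGModuleCat.{u} Λ) : ℕ :=
  sInf {n : ℕ | ∀ s ≥ n, Set.BijOn (omega Λ) (omegaSpan M s) (omegaSpan M (s + 1))}

/-- The Igusa-Todorov function `ψ_l`: the sum of `φ_l(M)` and the supremum of the finite
projective dimensions of the direct summands of `Ω^(φ_l(M))(M)`. (The zero summand, whose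
projective dimension is `⊥` in Mathlib, does not contribute; the supremum of `∅` is `0`.) -/
def psi (M : FGModuleCat.{u} Λ) : ℕ∞ :=
  phi M + sSup {m : ℕ∞ | ∃ (X : FGModuleCat.{u} Λ) (n : ℕ),
    IsSummand (Λ := Λ) X (syzygyIter (phi M) M) ∧ projectiveDimension X.obj = n ∧ m = n}

end Omega

section Evaluation

variable (Λ : Type u) [Ring Λ] (P : Type u) [AddCommGroup P] [Module Λ P]

/-- The ring `Γ = End_Λ(P)^op`. -/
abbrev Gam : Type u := (Module.End Λ P)ᵐᵒᵖ

variable (Y : Type u) [AddCommGroup Y] [Module Λ Y]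

/-- `Hom_Λ(P, Y)` as a left `Γ`-module: `γ ∈ Γ = End_Λ(P)^op` acts by precomposition. -/
instance homModule : Module (Gam Λ P) (P →ₗ[Λ] Y) where
  smul γ f := f ∘ₗ γ.unop
  one_smul _ := rfl
  mul_smul _ _ _ := rfl
  smul_zero _ := rfl
  smul_add _ _ _ := rfl
  add_smul γ δ f := LinearMap.comp_add γ.unop δ.unop f
  zero_smul f := LinearMap.comp_zero f

theorem gam_smul_apply (γ : Gam Λ P) (f : P →ₗ[Λ] Y) (p : P) : (γ • f) p = f (γ.unop p) := rfl

/-- Over an algebra finite over a noetherian `R`, the module `Hom_Λ(P, Y)` is finite over `R`. -/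
theorem finite_hom_base (R : Type u) [CommRing R] [IsNoetherianRing R] [Algebra R Λ]
    [Module R Y] [IsScalarTower R Λ Y] [SMulCommClass Λ R Y] [Module.Finite R Λ]
    [Module.Finite Λ P] [Module.Finite Λ Y] : Module.Finite R (P →ₗ[Λ] Y) := by
  have : Module.Finite R Y := Module.Finite.trans Λ Y
  obtain ⟨n, π, hπ⟩ := Module.Finite.exists_fin' Λ P
  let ev : (P →ₗ[Λ] Y) →ₗ[R] (Fin n → Y) :=
    { toFun := fun f i ↦ f (π (Pi.single i 1))
      map_add' := fun _ _ ↦ rfl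
      map_smul' := fun _ _ ↦ rfl }
  refine Module.Finite.of_injective ev fun f g hfg ↦ ?_
  have : f ∘ₗ π = g ∘ₗ π := by
    refine LinearMap.pi_ext' fun i ↦ LinearMap.ext_ring ?_
    exact congrFun hfg i
  exact LinearMap.ext fun p ↦ by
    obtain ⟨x, rfl⟩ := hπ p
    exact LinearMap.congr_fun this x

variable [IsArtinAlgebra Λ] [Module.Finite Λ P]

instance isArtinAlgebra_gam : IsArtinAlgebra (Gam Λ P) := by
  obtain ⟨R, _, _, _, _⟩ := IsArtinAlgebra.exists_base (Λ := Λ)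
  let _ : Module R P := Module.compHom P (algebraMap R Λ)
  have : IsScalarTower R Λ P := IsScalarTower.of_algebraMap_smul fun _ _ ↦ rfl
  have : SMulCommClass Λ R P := IsScalarTower.to_smulCommClass'
  have : Module.Finite R (Module.End Λ P) := finite_hom_base Λ P P R
  exact ⟨R, inferInstance, inferInstance, inferInstance,
    Module.Finite.equiv (MulOpposite.opLinearEquiv R : Module.End Λ P ≃ₗ[R] _)⟩

instance finite_hom [Module.Finite Λ Y] : Module.Finite (Gam Λ P) (P →ₗ[Λ] Y) := by
  obtain ⟨R, _, _, _, _⟩ := IsArtinAlgebra.exists_base (Λ := Λ)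
  let _ : Module R P := Module.compHom P (algebraMap R Λ)
  have : IsScalarTower R Λ P := IsScalarTower.of_algebraMap_smul fun _ _ ↦ rfl
  have : SMulCommClass Λ R P := IsScalarTower.to_smulCommClass'
  let _ : Module R Y := Module.compHom Y (algebraMap R Λ)
  have : IsScalarTower R Λ Y := IsScalarTower.of_algebraMap_smul fun _ _ ↦ rfl
  have : SMulCommClass Λ R Y := IsScalarTower.to_smulCommClass'
  have : Module.Finite R (P →ₗ[Λ] Y) := finite_hom_base Λ P Y R
  have : IsScalarTower R (Gam Λ P) (P →ₗ[Λ] Y) := by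
    refine IsScalarTower.of_algebraMap_smul fun r f ↦ LinearMap.ext fun p ↦ ?_
    change f (algebraMap R Λ r • p) = algebraMap R Λ r • f p
    exact f.map_smul _ _
  exact Module.Finite.of_restrictScalars_finite R (Gam Λ P) (P →ₗ[Λ] Y)

/-- The evaluation functor `e_P = Hom_Λ(P, -) : mod Λ → mod Γ` on objects. -/
def evalObj (Y : FGModuleCat.{u} Λ) : FGModuleCat.{u} (Gam Λ P) :=
  FGModuleCat.of (Gam Λ P) (P →ₗ[Λ] Y)

end Evaluation

end

end IgusaTodorov

/-!
Evaluation `Hom_Λ(P, -)` restricts to an equivalence from the modules presented by `add P` to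
`mod Γ`; its inverse is the coevaluation `P ⊗_Γ -`. On modules resolved by `add P`, evaluation
preserves and reflects direct summands and projectivity, preserves projective covers and hence
commutes with syzygies, and, by dimension shifting, is bijective on all `Ext` groups. The
statements about `d`-divisions and projective dimensions follow.

For `φ_l`, coevaluation induces a homomorphism `K_0(Γ) → K_0(Λ)`. It is injective: by cancellation
of modules of finite length, `[M] = [N]` means that `M × Q ≃ N × Q'` with `Q` and `Q'` projective,
and if `M` and `N` are generated by `add P`, then `Q` and `Q'` can be replaced by modules in
`add P`, on which evaluation is projective. It maps `⟨add Hom_Λ(P, Y)⟩` onto `⟨add Y⟩` and commutes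
with `Ω` on classes of modules resolved by `add P`, so `Ω` is injective on
`Ω^s(⟨add Hom_Λ(P, Y)⟩)` if and only if it is injective on `Ω^s(⟨add Y⟩)`.
-/


namespace IgusaTodorov

noncomputable section

/-! ### Direct summands and projective covers -/

section Summands

variable {Λ : Type u} [Ring Λ]
variable {M N X Y Q : Type u} [AddCommGroup M] [Module Λ M] [AddCommGroup N] [Module Λ N]
  [AddCommGroup X] [Module Λ X] [AddCommGroup Y] [Module Λ Y] [AddCommGroup Q] [Module Λ Q]

theorem IsSummand.of_equiv (e : X ≃ₗ[Λ] M) : IsSummand (Λ := Λ) X M :=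
  ⟨e, e.symm, by ext; simp⟩

theorem IsSummand.trans (h : IsSummand (Λ := Λ) X M) (h' : IsSummand (Λ := Λ) M N) :
    IsSummand (Λ := Λ) X N := by
  obtain ⟨i, p, hpi⟩ := h
  obtain ⟨j, q, hqj⟩ := h'
  exact ⟨j ∘ₗ i, p ∘ₗ q, by
    rw [LinearMap.comp_assoc, ← LinearMap.comp_assoc i, hqj, i.id_comp, hpi]⟩

theorem IsSummand.prod (h : IsSummand (Λ := Λ) X M) (h' : IsSummand (Λ := Λ) Y N) :
    IsSummand (Λ := Λ) (X × Y) (M × N) := by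
  obtain ⟨i, p, hpi⟩ := h
  obtain ⟨j, q, hqj⟩ := h'
  exact ⟨i.prodMap j, p.prodMap q, by rw [LinearMap.prodMap_comp, hpi, hqj, LinearMap.prodMap_id]⟩

theorem IsSummand.pi (h : IsSummand (Λ := Λ) X M) (k : ℕ) :
    IsSummand (Λ := Λ) (Fin k → X) (Fin k → M) := by
  obtain ⟨i, p, hpi⟩ := h
  exact ⟨i.compLeft (Fin k), p.compLeft (Fin k),
    LinearMap.ext fun x ↦ funext fun j ↦ LinearMap.congr_fun hpi (x j)⟩

theorem IsSummand.finite (h : IsSummand (Λ := Λ) X M) [Module.Finite Λ M] : Module.Finite Λ X := by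
  obtain ⟨i, p, hpi⟩ := h
  exact Module.Finite.of_surjective p (LinearMap.surjective_of_comp_eq_id i p hpi)

theorem IsSummand.projective (h : IsSummand (Λ := Λ) X M) [Module.Projective Λ M] :
    Module.Projective Λ X := by
  obtain ⟨i, p, hpi⟩ := h
  exact Module.Projective.of_split i p hpi

/-- A retraction splits its source as the kernel times the retract. -/
def equivKerProd {i : X →ₗ[Λ] M} {p : M →ₗ[Λ] X} (h : p ∘ₗ i = LinearMap.id) :
    M ≃ₗ[Λ] LinearMap.ker p × X :=
  ((LinearMap.exact_subtype_ker_map p).splitSurjectiveEquiv Subtype.val_injective ⟨i, h⟩).1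

/-- The kernel of a product of two maps is the product of their kernels. -/
def kerProdMapEquiv (f : M →ₗ[Λ] X) (g : N →ₗ[Λ] Y) :
    (LinearMap.ker f × LinearMap.ker g) ≃ₗ[Λ] LinearMap.ker (f.prodMap g) where
  toFun x := ⟨(x.1, x.2), by simp⟩
  invFun y := (⟨y.1.1, congrArg Prod.fst y.2⟩, ⟨y.1.2, congrArg Prod.snd y.2⟩)
  map_add' _ _ := rfl
  map_smul' _ _ := rfl

theorem InAdd.of_isSummand (h : IsSummand (Λ := Λ) X Q) (hQ : InAdd (Λ := Λ) M Q) :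
    InAdd (Λ := Λ) M X := by
  obtain ⟨n, hn⟩ := hQ
  exact ⟨n, h.trans hn⟩

theorem InAdd.pi_self (M : Type u) [AddCommGroup M] [Module Λ M] (k : ℕ) :
    InAdd (Λ := Λ) M (Fin k → M) :=
  ⟨k, IsSummand.of_equiv (LinearEquiv.refl Λ _)⟩

theorem InAdd.self (M : Type u) [AddCommGroup M] [Module Λ M] : InAdd (Λ := Λ) M M :=
  ⟨1, IsSummand.of_equiv (LinearEquiv.funUnique (Fin 1) Λ M).symm⟩

theorem InAdd.prod (hX : InAdd (Λ := Λ) M X) (hY : InAdd (Λ := Λ) M Y) :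
    InAdd (Λ := Λ) M (X × Y) := by
  obtain ⟨m, hm⟩ := hX
  obtain ⟨n, hn⟩ := hY
  exact ⟨m + n, (hm.prod hn).trans (IsSummand.of_equiv
    ((LinearEquiv.sumArrowLequivProdArrow (Fin m) (Fin n) Λ M).symm ≪≫ₗ
      LinearEquiv.funCongrLeft Λ M finSumFinEquiv.symm))⟩

theorem InAdd.pi (hQ : InAdd (Λ := Λ) M Q) (k : ℕ) : InAdd (Λ := Λ) M (Fin k → Q) := by
  obtain ⟨n, hn⟩ := hQ
  exact ⟨k * n, (hn.pi k).trans (IsSummand.of_equiv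
    ((LinearEquiv.curry Λ M (Fin k) (Fin n)).symm ≪≫ₗ
      LinearEquiv.funCongrLeft Λ M finProdFinEquiv.symm))⟩

theorem InAdd.finite (h : InAdd (Λ := Λ) M Q) [Module.Finite Λ M] : Module.Finite Λ Q := by
  obtain ⟨n, hn⟩ := h
  exact hn.finite

theorem InAdd.projective (h : InAdd (Λ := Λ) M Q) [Module.Projective Λ M] :
    Module.Projective Λ Q := by
  obtain ⟨n, hn⟩ := h
  have : Module.Projective Λ (Fin n → M) :=
    Module.Projective.of_equiv (DFinsupp.linearEquivFunOnFintype (R := Λ) (M := fun _ : Fin n ↦ M))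
  exact hn.projective

theorem InAdd.of_projective [Module.Finite Λ X] [Module.Projective Λ X] : InAdd (Λ := Λ) Λ X := by
  obtain ⟨n, f, hf⟩ := Module.Finite.exists_fin' Λ X
  obtain ⟨s, hs⟩ := Module.projective_lifting_property f LinearMap.id hf
  exact ⟨n, s, f, hs⟩

theorem InAdd.trans (h : InAdd (Λ := Λ) M Q) (hM : InAdd (Λ := Λ) N M) : InAdd (Λ := Λ) N Q := by
  obtain ⟨k, hk⟩ := h
  exact InAdd.of_isSummand hk (hM.pi k)

end Summands

section ProjectiveCovers

variable {Λ : Type u} [Ring Λ]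
variable {M N X Y Q C D : Type u} [AddCommGroup M] [Module Λ M] [AddCommGroup N] [Module Λ N]
  [AddCommGroup X] [Module Λ X] [AddCommGroup Y] [Module Λ Y] [AddCommGroup Q] [Module Λ Q]
  [AddCommGroup C] [Module Λ C] [AddCommGroup D] [Module Λ D]

theorem IsProjectiveCover.surjective_of_comp {π : C →ₗ[Λ] X} (hπ : IsProjectiveCover π)
    {a : Q →ₗ[Λ] C} (ha : Function.Surjective (π ∘ₗ a)) : Function.Surjective a := by
  rw [← LinearMap.range_eq_top]
  refine hπ.superfluous _ (eq_top_iff.2 fun c _ ↦ ?_)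
  obtain ⟨q, hq⟩ := ha (π c)
  have hker : c - a q ∈ LinearMap.ker π := by
    rw [LinearMap.mem_ker, map_sub, sub_eq_zero]
    exact hq.symm
  simpa using Submodule.add_mem_sup (LinearMap.mem_range_self a q) hker

theorem IsProjectiveCover.isSummand {π : C →ₗ[Λ] X} (hπ : IsProjectiveCover π)
    [Module.Projective Λ Q] {f : Q →ₗ[Λ] M} (hf : Function.Surjective f)
    (h : IsSummand (Λ := Λ) X M) :
    IsSummand (Λ := Λ) C Q ∧ IsSummand (Λ := Λ) (LinearMap.ker π) (LinearMap.ker f) := by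
  obtain ⟨i, p, hpi⟩ := h
  have := hπ.projective
  obtain ⟨α, hα⟩ := Module.projective_lifting_property f (i ∘ₗ π) hf
  obtain ⟨β, hβ⟩ := Module.projective_lifting_property π (p ∘ₗ f) hπ.surjective
  have hπβα : π ∘ₗ β ∘ₗ α = π := by
    rw [← LinearMap.comp_assoc, hβ, LinearMap.comp_assoc, hα, ← LinearMap.comp_assoc, hpi,
      LinearMap.id_comp]
  have hβα : Function.Surjective (β ∘ₗ α) :=
    hπ.surjective_of_comp (by rw [hπβα]; exact hπ.surjective)
  obtain ⟨γ, hγ⟩ := Module.projective_lifting_property (β ∘ₗ α) LinearMap.id hβα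
  have hπγ : π ∘ₗ γ = π := by
    conv_lhs => rw [← hπβα, LinearMap.comp_assoc, hγ, LinearMap.comp_id]
  have hα' : f ∘ₗ α ∘ₗ γ = i ∘ₗ π := by rw [← LinearMap.comp_assoc, hα, LinearMap.comp_assoc, hπγ]
  refine ⟨⟨α ∘ₗ γ, β, hγ⟩, (α ∘ₗ γ).restrict fun c hc ↦ ?_, β.restrict fun q hq ↦ ?_, ?_⟩
  · rw [LinearMap.mem_ker, ← LinearMap.comp_apply, hα', LinearMap.comp_apply,
      LinearMap.mem_ker.1 hc, map_zero]
  · rw [LinearMap.mem_ker, ← LinearMap.comp_apply, hβ, LinearMap.comp_apply,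
      LinearMap.mem_ker.1 hq, map_zero]
  · exact LinearMap.ext fun c ↦ Subtype.ext (LinearMap.congr_fun hγ c)

theorem IsProjectiveCover.nonempty_ker_equiv {π : C →ₗ[Λ] X} {ρ : D →ₗ[Λ] Y}
    (hπ : IsProjectiveCover π) (hρ : IsProjectiveCover ρ) (e : X ≃ₗ[Λ] Y) :
    Nonempty (LinearMap.ker π ≃ₗ[Λ] LinearMap.ker ρ) := by
  have := hπ.projective
  have := hρ.projective
  obtain ⟨s, hs⟩ := Module.projective_lifting_property ρ (e.toLinearMap ∘ₗ π) hρ.surjective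
  have hs_surj : Function.Surjective s :=
    hρ.surjective_of_comp (by rw [hs]; exact e.surjective.comp hπ.surjective)
  obtain ⟨t, ht⟩ := Module.projective_lifting_property s LinearMap.id hs_surj
  have hπt : e.toLinearMap ∘ₗ π ∘ₗ t = ρ := by
    rw [← LinearMap.comp_assoc, ← hs, LinearMap.comp_assoc, ht, LinearMap.comp_id]
  have ht_surj : Function.Surjective t := hπ.surjective_of_comp <| by
    have : Function.Surjective (e.toLinearMap ∘ₗ π ∘ₗ t) := by rw [hπt]; exact hρ.surjective
    exact Function.Surjective.of_comp_left this e.injective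
  have ht_inj : Function.Injective t := LinearMap.injective_of_comp_eq_id t s ht
  let ε : D ≃ₗ[Λ] C := LinearEquiv.ofBijective t ⟨ht_inj, ht_surj⟩
  refine ⟨(ε.ofSubmodules (LinearMap.ker ρ) (LinearMap.ker π) ?_).symm⟩
  rw [← hπt, LinearEquiv.ker_comp]
  exact (Submodule.map_comap_eq_of_surjective ht_surj (LinearMap.ker π))

end ProjectiveCovers

/-! ### Modules with a partial resolution in `add P` -/

section Presentations

variable (Λ : Type u) [Ring Λ] (P : Type u) [AddCommGroup P] [Module Λ P]

/-- `M` has a partial resolution `Q_{n-1} → ⋯ → Q_0 → M → 0` with all terms in `add P`, that is,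
`M ∈ ℙ_{n-1}` in the usual notation. -/
def HasAddPresentation : ℕ → (M : Type u) → [AddCommGroup M] → [Module Λ M] → Prop
  | 0, _, _, _ => True
  | n + 1, M, _, _ => ∃ (Q : ModuleCat.{u} Λ) (f : Q →ₗ[Λ] M),
      Function.Surjective f ∧ InAdd (Λ := Λ) P Q ∧ HasAddPresentation n (LinearMap.ker f)

/-- `M` has partial resolutions of every length with all terms in `add P`; equivalently
`M ∈ ℙ_∞`. -/
def IsAddResolved (M : Type u) [AddCommGroup M] [Module Λ M] : Prop :=
  ∀ n, HasAddPresentation Λ P n M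

variable {Λ P} {M N X : Type u} [AddCommGroup M] [Module Λ M] [AddCommGroup N] [Module Λ N]
  [AddCommGroup X] [Module Λ X]

theorem HasAddPresentation.of_succ {n : ℕ} (h : HasAddPresentation Λ P (n + 1) M) :
    HasAddPresentation Λ P n M := by
  induction n generalizing M with
  | zero => trivial
  | succ n ih =>
    obtain ⟨Q, f, hf, hQ, hK⟩ := h
    exact ⟨Q, f, hf, hQ, ih hK⟩

theorem HasAddPresentation.of_equiv {n : ℕ} (h : HasAddPresentation Λ P n M)
    (e : M ≃ₗ[Λ] N) : HasAddPresentation Λ P n N := by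
  cases n with
  | zero => trivial
  | succ n =>
    obtain ⟨Q, f, hf, hQ, hK⟩ := h
    refine ⟨Q, e.toLinearMap ∘ₗ f, e.surjective.comp hf, hQ, ?_⟩
    rwa [LinearEquiv.ker_comp]

theorem HasAddPresentation.prod {n : ℕ} (hM : HasAddPresentation Λ P n M)
    (hN : HasAddPresentation Λ P n N) : HasAddPresentation Λ P n (M × N) := by
  induction n generalizing M N with
  | zero => trivial
  | succ n ih =>
    obtain ⟨Q, f, hf, hQ, hK⟩ := hM
    obtain ⟨R, g, hg, hR, hL⟩ := hN
    refine ⟨ModuleCat.of Λ (Q × R), f.prodMap g, hf.prodMap hg, hQ.prod hR, ?_⟩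
    exact (ih hK hL).of_equiv (kerProdMapEquiv f g)

theorem HasAddPresentation.finite [Module.Finite Λ P] {n : ℕ}
    (h : HasAddPresentation Λ P (n + 1) M) : Module.Finite Λ M := by
  obtain ⟨Q, f, hf, hQ, -⟩ := h
  have := hQ.finite
  exact Module.Finite.of_surjective f hf

theorem HasAddPresentation.inAdd_of_isSummand_of_projective (h : HasAddPresentation Λ P 1 M)
    (hX : IsSummand (Λ := Λ) X M) [Module.Projective Λ X] : InAdd (Λ := Λ) P X := by
  obtain ⟨Q, f, hf, hQ, -⟩ := h
  obtain ⟨i, p, hpi⟩ := hX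
  obtain ⟨s, hs⟩ := Module.projective_lifting_property (p ∘ₗ f) LinearMap.id
    ((LinearMap.surjective_of_comp_eq_id i p hpi).comp hf)
  exact .of_isSummand ⟨s, p ∘ₗ f, hs⟩ hQ

theorem HasAddPresentation.of_subsingleton [Subsingleton M] (n : ℕ) :
    HasAddPresentation Λ P n M := by
  induction n generalizing M with
  | zero => trivial
  | succ n ih =>
    exact ⟨ModuleCat.of Λ (Fin 0 → P), 0, fun x ↦ ⟨0, Subsingleton.elim _ _⟩,
      InAdd.pi_self P 0, ih⟩

theorem InAdd.isAddResolved (h : InAdd (Λ := Λ) P M) : IsAddResolved Λ P M := by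
  rintro (_ | n)
  · trivial
  · refine ⟨ModuleCat.of Λ M, LinearMap.id, Function.surjective_id, h, ?_⟩
    rw [LinearMap.ker_id]
    exact HasAddPresentation.of_subsingleton n

theorem HasAddPresentation.pi {n : ℕ} (h : HasAddPresentation Λ P n M) (k : ℕ) :
    HasAddPresentation Λ P n (Fin k → M) := by
  induction k with
  | zero => exact .of_subsingleton n
  | succ k ih => exact (h.prod ih).of_equiv (Fin.consLinearEquiv Λ fun _ ↦ M)

theorem HasAddPresentation.ker_of_exact {A B C : Type u} [AddCommGroup A] [Module Λ A]
    [AddCommGroup B] [Module Λ B] [AddCommGroup C] [Module Λ C] {f : A →ₗ[Λ] B} {g : B →ₗ[Λ] C}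
    (hfg : Function.Exact f g) (hA : InAdd (Λ := Λ) P A) {n : ℕ}
    (h : HasAddPresentation Λ P n (LinearMap.ker f)) :
    HasAddPresentation Λ P (n + 1) (LinearMap.ker g) := by
  refine ⟨ModuleCat.of Λ A, f.codRestrict _ fun x ↦
    LinearMap.mem_ker.2 (hfg.apply_apply_eq_zero x), ?_, hA, ?_⟩
  · rintro ⟨y, hy⟩
    obtain ⟨x, rfl⟩ := (hfg y).1 hy
    exact ⟨x, rfl⟩
  · rw [LinearMap.ker_codRestrict]
    exact h

section Covers

variable [IsArtinianRing Λ] [Module.Projective Λ P]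

theorem HasAddPresentation.cover_of_isSummand {n : ℕ} {X : FGModuleCat.{u} Λ}
    (h : HasAddPresentation Λ P (n + 1) M) (hX : IsSummand (Λ := Λ) X M) :
    InAdd (Λ := Λ) P (coverObj X) ∧ ∃ K : ModuleCat.{u} Λ,
      HasAddPresentation Λ P n K ∧ IsSummand (Λ := Λ) (syzygy X) K := by
  obtain ⟨Q, f, hf, hQ, hK⟩ := h
  have := hQ.projective
  obtain ⟨hcover, hsyzygy⟩ := (isProjectiveCover_coverMap X).isSummand hf hX
  exact ⟨InAdd.of_isSummand hcover hQ, ModuleCat.of Λ (LinearMap.ker f), hK, hsyzygy⟩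

theorem HasAddPresentation.inAdd_coverObj {n : ℕ} {X : FGModuleCat.{u} Λ}
    (h : HasAddPresentation Λ P (n + 1) X) : InAdd (Λ := Λ) P (coverObj X) :=
  (h.cover_of_isSummand (IsSummand.of_equiv (LinearEquiv.refl Λ X))).1

variable [Module.Finite Λ P]

theorem HasAddPresentation.of_isSummand {n : ℕ} (h : HasAddPresentation Λ P n M)
    (hX : IsSummand (Λ := Λ) X M) : HasAddPresentation Λ P n X := by
  induction n generalizing M X with
  | zero => trivial
  | succ n ih =>
    have := h.finite
    have := hX.finite
    obtain ⟨hcover, K, hK, hsyzygy⟩ := h.cover_of_isSummand (X := FGModuleCat.of Λ X) hX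
    exact ⟨(coverObj (FGModuleCat.of Λ X)).obj, coverMap (FGModuleCat.of Λ X),
      (isProjectiveCover_coverMap _).surjective, hcover, ih hK hsyzygy⟩

theorem HasAddPresentation.syzygy {n : ℕ} {X : FGModuleCat.{u} Λ}
    (h : HasAddPresentation Λ P (n + 1) X) : HasAddPresentation Λ P n (syzygy X) := by
  obtain ⟨-, K, hK, hs⟩ := h.cover_of_isSummand (IsSummand.of_equiv (LinearEquiv.refl Λ X))
  exact hK.of_isSummand hs

theorem IsAddResolved.of_isSummand (h : IsAddResolved Λ P M)
    (hX : IsSummand (Λ := Λ) X M) : IsAddResolved Λ P X :=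
  fun n ↦ (h n).of_isSummand hX

theorem IsAddResolved.of_inAdd (h : IsAddResolved Λ P M)
    (hX : InAdd (Λ := Λ) M X) : IsAddResolved Λ P X := by
  obtain ⟨k, hk⟩ := hX
  exact fun n ↦ ((h n).pi k).of_isSummand hk

theorem IsAddResolved.syzygy {X : FGModuleCat.{u} Λ} (h : IsAddResolved Λ P X) :
    IsAddResolved Λ P (syzygy X) :=
  fun n ↦ (h (n + 1)).syzygy

theorem IsAddResolved.syzygyIter {X : FGModuleCat.{u} Λ} (h : IsAddResolved Λ P X) (n : ℕ) :
    IsAddResolved Λ P (syzygyIter n X) := by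
  induction n generalizing X with
  | zero => exact h
  | succ _ ih => exact ih h.syzygy

end Covers

end Presentations

section Resolutions

variable {Λ : Type u} [Ring Λ] {P : Type u} [AddCommGroup P] [Module Λ P]

theorem HasAddResolution.isAddResolved {Y : FGModuleCat.{u} Λ} (h : HasAddResolution P Y) :
    IsAddResolved Λ P Y := by
  obtain ⟨Q, hQ⟩ := h
  have hd (n i : ℕ) : HasAddPresentation Λ P n (LinearMap.ker (Q.complex.d (i + 1) i).hom) := by
    induction n generalizing i with
    | zero => trivial
    | succ n ih =>
      exact .ker_of_exact ((ShortComplex.ShortExact.moduleCat_exact_iff_function_exact _).1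
        (Q.exact_succ i)) (hQ (i + 2)) (ih (i + 1))
  have hπ (n : ℕ) : HasAddPresentation Λ P n (LinearMap.ker (Q.π.f 0).hom) := by
    cases n with
    | zero => trivial
    | succ n =>
      exact .ker_of_exact ((ShortComplex.ShortExact.moduleCat_exact_iff_function_exact _).1
        Q.exact₀) (hQ 1) (hd n 0)
  rintro (_ | n)
  · trivial
  · exact ⟨_, (Q.π.f 0).hom, (ModuleCat.epi_iff_surjective _).1 inferInstance, hQ 0, hπ n⟩

end Resolutions

/-! ### Cancellation of modules of finite length -/

section Cancellation

variable {Λ : Type u} [Ring Λ]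
variable {M N Z : Type u} [AddCommGroup M] [Module Λ M] [AddCommGroup N] [Module Λ N]
  [AddCommGroup Z] [Module Λ Z]

theorem isIndecomposable_iff_isIdempotentElem_end :
    IsIndecomposable (Λ := Λ) M ↔ Nontrivial (Module.End Λ M) ∧
      ∀ a : Module.End Λ M, IsIdempotentElem a → a = 0 ∨ a = 1 := by
  refine and_congr ⟨fun _ ↦ inferInstance, fun _ ↦ ?_⟩ ⟨fun h a ha ↦ ?_, fun h A B hAB ↦ ?_⟩
  · by_contra hM
    rw [not_nontrivial_iff_subsingleton] at hM
    exact not_subsingleton (Module.End Λ M) inferInstance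
  · refine (h _ _ (LinearMap.IsIdempotentElem.isCompl ha)).imp LinearMap.range_eq_bot.1
      fun hker ↦ ?_
    exact LinearMap.ext fun x ↦ LinearMap.ker_eq_bot.1 hker (LinearMap.congr_fun ha x)
  · refine (h (A.projection B hAB) (Submodule.isIdempotentElem_projection hAB)).imp (fun h0 ↦ ?_)
      fun h1 ↦ ?_
    · rw [← Submodule.range_projection hAB, h0, LinearMap.range_zero]
    · rw [← Submodule.ker_projection hAB, h1, Module.End.one_eq_id, LinearMap.ker_id]

theorem nonempty_ker_equiv_of_bijective_comp_inr {q : M × Z →ₗ[Λ] Z}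
    (hq : Function.Bijective (q ∘ₗ LinearMap.inr Λ M Z)) :
    Nonempty (LinearMap.ker q ≃ₗ[Λ] M) := by
  have hsplit : ∀ m z, q (m, z) = q (m, 0) + q (0, z) := fun m z ↦ by simp [← map_add]
  refine ⟨LinearEquiv.ofBijective (LinearMap.fst Λ M Z ∘ₗ (LinearMap.ker q).subtype)
    ⟨(injective_iff_map_eq_zero _).2 ?_, fun m ↦ ?_⟩⟩
  · rintro ⟨⟨m, z⟩, hmz⟩ (rfl : m = 0)
    have hz : z = 0 := hq.1 (hmz.trans (map_zero _).symm)
    simp [hz]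
  · obtain ⟨z, hz⟩ := hq.2 (-q (m, 0))
    have hz' : q (0, z) = -q (m, 0) := hz
    exact ⟨⟨(m, z), by rw [LinearMap.mem_ker, hsplit, hz', add_neg_cancel]⟩, rfl⟩

theorem nonempty_equiv_of_bijective_coprod (e : (M × Z) ≃ₗ[Λ] (N × Z)) (c : N →ₗ[Λ] Z)
    (h : Function.Bijective
      (c.coprod LinearMap.id ∘ₗ e.toLinearMap ∘ₗ LinearMap.inr Λ M Z)) :
    Nonempty (M ≃ₗ[Λ] N) := by
  obtain ⟨eM⟩ := nonempty_ker_equiv_of_bijective_comp_inr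
    (q := c.coprod LinearMap.id ∘ₗ e.toLinearMap) h
  obtain ⟨eN⟩ := nonempty_ker_equiv_of_bijective_comp_inr (q := c.coprod LinearMap.id)
    (by rw [LinearMap.coprod_inr]; exact Function.bijective_id)
  refine ⟨eM.symm ≪≫ₗ e.ofSubmodules _ _ ?_ ≪≫ₗ eN⟩
  rw [LinearMap.ker_comp]
  exact Submodule.map_comap_eq_of_surjective e.surjective _

theorem IsIndecomposable.isNilpotent_or_bijective [IsNoetherian Λ Z] [IsArtinian Λ Z]
    (hZ : IsIndecomposable (Λ := Λ) Z) (a : Module.End Λ Z) :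
    IsNilpotent a ∨ Function.Bijective a := by
  obtain ⟨n, hn⟩ := Filter.eventually_atTop.1 a.eventually_isCompl_ker_pow_range_pow
  rcases hZ.2 _ _ (hn (n + 1) n.le_succ) with hker | hrange
  · refine Or.inr (IsArtinian.bijective_of_injective_endomorphism a ?_)
    have hinj : Function.Injective (a ^ n * a) := by
      rwa [← pow_succ, ← LinearMap.ker_eq_bot]
    exact Function.Injective.of_comp (f := ⇑(a ^ n)) hinj
  · exact Or.inl ⟨n + 1, LinearMap.range_eq_bot.1 hrange⟩

theorem IsIndecomposable.cancel [IsNoetherian Λ Z] [IsArtinian Λ Z]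
    (hZ : IsIndecomposable (Λ := Λ) Z) (e : (M × Z) ≃ₗ[Λ] (N × Z)) : Nonempty (M ≃ₗ[Λ] N) := by
  let b : Z →ₗ[Λ] N := LinearMap.fst Λ N Z ∘ₗ e.toLinearMap ∘ₗ LinearMap.inr Λ M Z
  let d : Module.End Λ Z := LinearMap.snd Λ N Z ∘ₗ e.toLinearMap ∘ₗ LinearMap.inr Λ M Z
  let c' : N →ₗ[Λ] Z := LinearMap.snd Λ M Z ∘ₗ e.symm.toLinearMap ∘ₗ LinearMap.inl Λ N Z
  let d' : Module.End Λ Z := LinearMap.snd Λ M Z ∘ₗ e.symm.toLinearMap ∘ₗ LinearMap.inr Λ N Z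
  have hinv : c' ∘ₗ b + d' * d = 1 := LinearMap.ext fun z ↦ by
    simp [b, d, c', d', ← Prod.snd_add, ← map_add]
  rcases hZ.isNilpotent_or_bijective (d' * d) with hnil | hbij
  · obtain ⟨t, ht⟩ := hnil.isUnit_one_sub
    have hcb : c' ∘ₗ b = (t : Module.End Λ Z) := by rw [ht, ← hinv, add_sub_cancel_right]
    let s : Module.End Λ Z := (1 - d) * (↑t⁻¹ : Module.End Λ Z)
    have hs : (s ∘ₗ c').coprod LinearMap.id ∘ₗ e.toLinearMap ∘ₗ LinearMap.inr Λ M Z = 1 :=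
      calc (s ∘ₗ c').coprod LinearMap.id ∘ₗ e.toLinearMap ∘ₗ LinearMap.inr Λ M Z
          = s * (c' ∘ₗ b) + d := rfl
        _ = 1 := by rw [hcb, Units.inv_mul_cancel_right, sub_add_cancel]
    refine nonempty_equiv_of_bijective_coprod e (s ∘ₗ c') ?_
    rw [hs]
    exact Function.bijective_id
  · refine nonempty_equiv_of_bijective_coprod e 0 ?_
    have hd : (0 : N →ₗ[Λ] Z).coprod LinearMap.id ∘ₗ e.toLinearMap ∘ₗ LinearMap.inr Λ M Z = d :=
      LinearMap.ext fun z ↦ zero_add (d z)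
    rw [hd]
    exact IsArtinian.bijective_of_injective_endomorphism d
      (Function.Injective.of_comp (f := d') hbij.1)

theorem nonempty_equiv_of_prod_equiv [IsNoetherian Λ Z] [IsArtinian Λ Z]
    (e : (M × Z) ≃ₗ[Λ] (N × Z)) : Nonempty (M ≃ₗ[Λ] N) := by
  induction hl : Module.length Λ Z using WellFoundedLT.induction generalizing M N Z with
  | ind l ih =>
    rcases subsingleton_or_nontrivial Z with hZ | hZ
    · have := uniqueOfSubsingleton (0 : Z)
      exact ⟨(LinearEquiv.prodUnique (R := Λ)).symm ≪≫ₗ e ≪≫ₗ LinearEquiv.prodUnique⟩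
    by_cases hind : IsIndecomposable (Λ := Λ) Z
    · exact hind.cancel e
    obtain ⟨A, B, hAB, hA, hB⟩ : ∃ A B : Submodule Λ Z, IsCompl A B ∧ A ≠ ⊥ ∧ B ≠ ⊥ := by
      simpa [IsIndecomposable, hZ] using hind
    have hA_lt : Module.length Λ A < l :=
      hl ▸ Submodule.length_lt fun h ↦ hB (hAB.disjoint.eq_bot_of_ge (h ▸ le_top))
    have hB_lt : Module.length Λ B < l :=
      hl ▸ Submodule.length_lt fun h ↦ hA (hAB.disjoint.eq_bot_of_le (h ▸ le_top))
    let D (L : Type u) [AddCommGroup L] [Module Λ L] : (L × Z) ≃ₗ[Λ] (L × A) × B :=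
      (LinearEquiv.refl Λ L).prodCongr (Submodule.prodEquivOfIsCompl A B hAB).symm ≪≫ₗ
        (LinearEquiv.prodAssoc Λ L A B).symm
    obtain ⟨e'⟩ := ih _ hB_lt ((D M).symm ≪≫ₗ e ≪≫ₗ D N) rfl
    exact ih _ hA_lt e' rfl

end Cancellation

/-! ### Stable equivalence and equality in `K_0` -/

section StableClasses

variable {Λ : Type u} [Ring Λ]

variable (Λ) in
/-- The zero module. -/
abbrev zeroObj : FGModuleCat.{u} Λ := FGModuleCat.of Λ PUnit.{u + 1}

/-- `M` and `N` become isomorphic after adding projective modules. -/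
def IsStablyEquiv (M N : FGModuleCat.{u} Λ) : Prop :=
  ∃ Q Q' : FGModuleCat.{u} Λ, Module.Projective Λ Q ∧ Module.Projective Λ Q' ∧
    Nonempty ((M × Q) ≃ₗ[Λ] (N × Q'))

theorem IsStablyEquiv.of_equiv {M N : FGModuleCat.{u} Λ} (e : M ≃ₗ[Λ] N) : IsStablyEquiv M N :=
  ⟨zeroObj Λ, zeroObj Λ, inferInstance, inferInstance, ⟨e.prodCongr (LinearEquiv.refl Λ _)⟩⟩

theorem IsStablyEquiv.symm {M N : FGModuleCat.{u} Λ} (h : IsStablyEquiv M N) :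
    IsStablyEquiv N M := by
  obtain ⟨Q, Q', hQ, hQ', ⟨e⟩⟩ := h
  exact ⟨Q', Q, hQ', hQ, ⟨e.symm⟩⟩

/-- Interchange of the last two factors of a product. -/
def prodRightComm (A B C : Type u) [AddCommGroup A] [Module Λ A] [AddCommGroup B] [Module Λ B]
    [AddCommGroup C] [Module Λ C] : ((A × B) × C) ≃ₗ[Λ] ((A × C) × B) :=
  LinearEquiv.prodAssoc Λ A B C ≪≫ₗ
    (LinearEquiv.refl Λ A).prodCongr (LinearEquiv.prodComm Λ B C) ≪≫ₗ
    (LinearEquiv.prodAssoc Λ A C B).symm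

theorem IsStablyEquiv.trans {L M N : FGModuleCat.{u} Λ} (h : IsStablyEquiv L M)
    (h' : IsStablyEquiv M N) : IsStablyEquiv L N := by
  obtain ⟨Q, Q', hQ, hQ', ⟨e⟩⟩ := h
  obtain ⟨R, R', hR, hR', ⟨e'⟩⟩ := h'
  exact ⟨FGModuleCat.of Λ (Q × R), FGModuleCat.of Λ (R' × Q'), inferInstance, inferInstance,
    ⟨(LinearEquiv.prodAssoc Λ L Q R).symm ≪≫ₗ e.prodCongr (LinearEquiv.refl Λ R) ≪≫ₗ
      prodRightComm M Q' R ≪≫ₗ e'.prodCongr (LinearEquiv.refl Λ Q') ≪≫ₗ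
      LinearEquiv.prodAssoc Λ N R' Q'⟩⟩

theorem IsStablyEquiv.prod {M N M' N' : FGModuleCat.{u} Λ} (h : IsStablyEquiv M N)
    (h' : IsStablyEquiv M' N') :
    IsStablyEquiv (FGModuleCat.of Λ (M × M')) (FGModuleCat.of Λ (N × N')) := by
  obtain ⟨Q, Q', hQ, hQ', ⟨e⟩⟩ := h
  obtain ⟨R, R', hR, hR', ⟨e'⟩⟩ := h'
  exact ⟨FGModuleCat.of Λ (Q × R), FGModuleCat.of Λ (Q' × R'), inferInstance, inferInstance,
    ⟨LinearEquiv.prodProdProdComm Λ M M' Q R ≪≫ₗ e.prodCongr e' ≪≫ₗ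
      LinearEquiv.prodProdProdComm Λ N Q' N' R'⟩⟩

theorem IsStablyEquiv.of_prod_left [IsArtinianRing Λ] {M N Z : FGModuleCat.{u} Λ}
    (h : IsStablyEquiv (FGModuleCat.of Λ (Z × M)) (FGModuleCat.of Λ (Z × N))) :
    IsStablyEquiv M N := by
  obtain ⟨Q, Q', hQ, hQ', ⟨e⟩⟩ := h
  let swap (L R : Type u) [AddCommGroup L] [Module Λ L] [AddCommGroup R] [Module Λ R] :
      ((L × R) × Z) ≃ₗ[Λ] (Z × L) × R :=
    LinearEquiv.prodComm Λ (L × R) Z ≪≫ₗ (LinearEquiv.prodAssoc Λ Z L R).symm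
  exact ⟨Q, Q', hQ, hQ', nonempty_equiv_of_prod_equiv (swap M Q ≪≫ₗ e ≪≫ₗ (swap N Q').symm)⟩

variable (Λ) in
/-- Stable equivalence of finitely generated modules. -/
def stableSetoid : Setoid (FGModuleCat.{u} Λ) where
  r := IsStablyEquiv
  iseqv := ⟨fun M ↦ .of_equiv (LinearEquiv.refl Λ M), IsStablyEquiv.symm, IsStablyEquiv.trans⟩

variable (Λ) in
/-- The monoid of stable equivalence classes of finitely generated modules under direct sum. Its
Grothendieck group detects equality in `K_0`. -/
def StableClass : Type (u + 1) := Quotient (stableSetoid Λ)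

namespace StableClass

/-- The stable equivalence class of a module. -/
def mk (M : FGModuleCat.{u} Λ) : StableClass Λ := Quotient.mk (stableSetoid Λ) M

theorem mk_eq_mk {M N : FGModuleCat.{u} Λ} : mk M = mk N ↔ IsStablyEquiv M N :=
  Quotient.eq (r := stableSetoid Λ)

instance : Zero (StableClass Λ) := ⟨mk (zeroObj Λ)⟩

instance : Add (StableClass Λ) :=
  ⟨Quotient.map₂ (fun M N ↦ FGModuleCat.of Λ (M × N)) fun _ _ h _ _ h' ↦ h.prod h'⟩

instance : AddCommMonoid (StableClass Λ) where
  add_assoc := by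
    rintro ⟨A⟩ ⟨B⟩ ⟨C⟩
    exact mk_eq_mk.2 (.of_equiv (LinearEquiv.prodAssoc Λ A B C))
  zero_add := by
    rintro ⟨A⟩
    exact mk_eq_mk.2 (.of_equiv (LinearEquiv.uniqueProd (R := Λ) (M := A)))
  add_zero := by
    rintro ⟨A⟩
    exact mk_eq_mk.2 (.of_equiv (LinearEquiv.prodUnique (R := Λ) (M := A)))
  add_comm := by
    rintro ⟨A⟩ ⟨B⟩
    exact mk_eq_mk.2 (.of_equiv (LinearEquiv.prodComm Λ A B))
  nsmul := nsmulRec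

theorem mk_eq_add {A B C : FGModuleCat.{u} Λ} (e : C ≃ₗ[Λ] A × B) : mk C = mk A + mk B :=
  mk_eq_mk.2 (.of_equiv e)

theorem mk_eq_zero (Q : FGModuleCat.{u} Λ) (hQ : Module.Projective Λ Q) : mk Q = 0 :=
  mk_eq_mk.2 ⟨zeroObj Λ, Q, inferInstance, hQ, ⟨LinearEquiv.prodComm Λ Q (zeroObj Λ)⟩⟩

instance [IsArtinianRing Λ] : IsLeftCancelAdd (StableClass Λ) where
  add_left_cancel := by
    rintro ⟨Z⟩ ⟨M⟩ ⟨N⟩ h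
    exact mk_eq_mk.2 (mk_eq_mk.1 h).of_prod_left

instance [IsArtinianRing Λ] : IsCancelAdd (StableClass Λ) :=
  AddCommMagma.IsLeftCancelAdd.toIsCancelAdd _

end StableClass

namespace K0

variable (Λ) in
/-- The comparison of `K_0` with the Grothendieck group of the monoid of stable classes. -/
def toGrothendieck : K0 Λ →+ Algebra.GrothendieckAddGroup (StableClass Λ) :=
  QuotientAddGroup.lift (AddSubgroup.closure (k0Relations Λ))
    (FreeAbelianGroup.lift fun M ↦ Algebra.GrothendieckAddGroup.of (StableClass.mk M)) <| by
    rw [AddSubgroup.closure_le]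
    rintro x (⟨A, B, C, ⟨e⟩, rfl⟩ | ⟨Q, hQ, rfl⟩)
    · simp [StableClass.mk_eq_add e]
    · simp [StableClass.mk_eq_zero Q hQ]

theorem toGrothendieck_cls (M : FGModuleCat.{u} Λ) :
    toGrothendieck Λ (cls M) = Algebra.GrothendieckAddGroup.of (StableClass.mk M) := by
  simp [toGrothendieck, cls]

theorem isStablyEquiv_of_cls_eq [IsArtinianRing Λ] {M N : FGModuleCat.{u} Λ}
    (h : cls M = cls N) : IsStablyEquiv M N := by
  rw [← StableClass.mk_eq_mk, ← Algebra.GrothendieckAddGroup.of_injective.eq_iff,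
    ← toGrothendieck_cls, ← toGrothendieck_cls, h]

theorem cls_congr {M N : FGModuleCat.{u} Λ} (e : M ≃ₗ[Λ] N) : cls M = cls N := by
  have h := cls_prod (C := M) (A := N) (B := zeroObj Λ)
    (e ≪≫ₗ (LinearEquiv.prodUnique (R := Λ)).symm)
  rwa [cls_projective (zeroObj Λ) inferInstance, add_zero] at h

theorem cls_prod_projective {M Q N R : FGModuleCat.{u} Λ} (e : (M × Q) ≃ₗ[Λ] N × R)
    (hQ : Module.Projective Λ Q) (hR : Module.Projective Λ R) : cls M = cls N := by
  have hM := cls_prod (C := FGModuleCat.of Λ (M × Q)) (LinearEquiv.refl Λ (M × Q))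
  rw [cls_prod e, cls_projective Q hQ, cls_projective R hR, add_zero, add_zero] at hM
  exact hM.symm

theorem exists_eq_cls_sub_cls (x : K0 Λ) : ∃ M N : FGModuleCat.{u} Λ, x = cls M - cls N := by
  have hO : cls (zeroObj Λ) = 0 := cls_projective _ inferInstance
  obtain ⟨x, rfl⟩ := QuotientAddGroup.mk_surjective x
  induction x using FreeAbelianGroup.induction_on with
  | zero => exact ⟨zeroObj Λ, zeroObj Λ, by simp⟩
  | of M => exact ⟨M, zeroObj Λ, by rw [hO, sub_zero]; rfl⟩
  | neg M _ => exact ⟨zeroObj Λ, M, by rw [hO, zero_sub]; rfl⟩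
  | add x y hx hy =>
    obtain ⟨M, N, hx⟩ := hx
    obtain ⟨M', N', hy⟩ := hy
    refine ⟨FGModuleCat.of Λ (M × M'), FGModuleCat.of Λ (N × N'), ?_⟩
    rw [QuotientAddGroup.mk_add, hx, hy,
      cls_prod (C := FGModuleCat.of Λ (M × M')) (LinearEquiv.refl Λ (M × M')),
      cls_prod (C := FGModuleCat.of Λ (N × N')) (LinearEquiv.refl Λ (N × N'))]
    abel

end K0

end StableClasses

/-! ### The functor `Hom(P, -)` on modules presented by `add P` -/

section Hom

variable {Λ : Type u} [Ring Λ] (P : Type u) [AddCommGroup P] [Module Λ P]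
  {L M N Q : Type u} [AddCommGroup L] [Module Λ L] [AddCommGroup M] [Module Λ M]
  [AddCommGroup N] [Module Λ N] [AddCommGroup Q] [Module Λ Q]

/-- The functor `Hom_Λ(P, -)` on morphisms. -/
def homMap (f : M →ₗ[Λ] N) : (P →ₗ[Λ] M) →ₗ[Gam Λ P] (P →ₗ[Λ] N) where
  toFun a := f ∘ₗ a
  map_add' _ _ := LinearMap.comp_add _ _ _
  map_smul' _ _ := rfl

@[simp]
theorem homMap_apply (f : M →ₗ[Λ] N) (a : P →ₗ[Λ] M) : homMap P f a = f ∘ₗ a := rfl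

theorem homMap_comp (g : M →ₗ[Λ] N) (f : L →ₗ[Λ] M) :
    homMap P (g ∘ₗ f) = homMap P g ∘ₗ homMap P f := rfl

theorem homMap_id : homMap P (LinearMap.id : M →ₗ[Λ] M) = LinearMap.id := rfl

/-- `Hom_Λ(P, -)` on isomorphisms. -/
def homEquiv (e : M ≃ₗ[Λ] N) : (P →ₗ[Λ] M) ≃ₗ[Gam Λ P] (P →ₗ[Λ] N) :=
  LinearEquiv.ofLinearMap (homMap P e.toLinearMap) (homMap P e.symm.toLinearMap)
    (by ext; simp) (by ext; simp)

/-- `Hom_Λ(P, -)` preserves binary products. -/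
def homProdEquiv : (P →ₗ[Λ] M × N) ≃ₗ[Gam Λ P] (P →ₗ[Λ] M) × (P →ₗ[Λ] N) where
  toFun a := (LinearMap.fst Λ M N ∘ₗ a, LinearMap.snd Λ M N ∘ₗ a)
  invFun b := b.1.prod b.2
  map_add' _ _ := rfl
  map_smul' _ _ := rfl

/-- `Hom_Λ(P, -)` preserves finite powers. -/
def homPiEquiv (k : ℕ) : (P →ₗ[Λ] (Fin k → M)) ≃ₗ[Gam Λ P] (Fin k → (P →ₗ[Λ] M)) where
  toFun a j := LinearMap.proj j ∘ₗ a
  invFun b := LinearMap.pi b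
  map_add' _ _ := rfl
  map_smul' _ _ := rfl

/-- `Hom_Λ(P, -)` preserves kernels. -/
def homKerEquiv (f : M →ₗ[Λ] N) :
    (P →ₗ[Λ] LinearMap.ker f) ≃ₗ[Gam Λ P] LinearMap.ker (homMap P f) where
  toFun a := ⟨Submodule.subtype _ ∘ₗ a, LinearMap.ext fun x ↦ (a x).2⟩
  invFun b := LinearMap.codRestrict _ b.1 fun x ↦ LinearMap.congr_fun b.2 x
  map_add' _ _ := rfl
  map_smul' _ _ := rfl

/-- `Hom_Λ(P, P)` is the regular module. -/
def homSelfEquiv : (P →ₗ[Λ] P) ≃ₗ[Gam Λ P] Gam Λ P where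
  toFun a := MulOpposite.op a
  invFun γ := γ.unop
  map_add' _ _ := rfl
  map_smul' _ _ := rfl

/-- `Hom_Λ(P, P ^ k)` is the free module of rank `k`. -/
def homPiSelfEquiv (k : ℕ) : (P →ₗ[Λ] (Fin k → P)) ≃ₗ[Gam Λ P] (Fin k → Gam Λ P) :=
  homPiEquiv P k ≪≫ₗ LinearEquiv.piCongrRight fun _ ↦ homSelfEquiv P

variable {P}

theorem homMap_injective {f : M →ₗ[Λ] N} (hf : Function.Injective f) :
    Function.Injective (homMap P f) := fun _ _ h ↦ (LinearMap.cancel_left hf).1 h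

theorem IsSummand.hom (h : IsSummand (Λ := Λ) M N) :
    IsSummand (Λ := Gam Λ P) (P →ₗ[Λ] M) (P →ₗ[Λ] N) := by
  obtain ⟨i, p, hip⟩ := h
  exact ⟨homMap P i, homMap P p, by rw [← homMap_comp, hip, homMap_id]⟩

theorem InAdd.hom (h : InAdd (Λ := Λ) M N) : InAdd (Λ := Gam Λ P) (P →ₗ[Λ] M) (P →ₗ[Λ] N) := by
  obtain ⟨n, hn⟩ := h
  exact ⟨n, hn.hom.trans (IsSummand.of_equiv (homPiEquiv P n))⟩

theorem InAdd.projective_hom (h : InAdd (Λ := Λ) P Q) :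
    Module.Projective (Gam Λ P) (P →ₗ[Λ] Q) := by
  have : Module.Projective (Gam Λ P) (P →ₗ[Λ] P) :=
    Module.Projective.of_equiv (homSelfEquiv P).symm
  exact h.hom.projective

theorem InAdd.exists_dual_basis (h : InAdd (Λ := Λ) P Q) :
    ∃ (n : ℕ) (a : Fin n → P →ₗ[Λ] Q) (b : Fin n → Q →ₗ[Λ] P),
      ∑ k, a k ∘ₗ b k = LinearMap.id := by
  obtain ⟨n, i, p, hip⟩ := h
  refine ⟨n, fun k ↦ p ∘ₗ LinearMap.single Λ (fun _ ↦ P) k, fun k ↦ LinearMap.proj k ∘ₗ i,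
    LinearMap.ext fun q ↦ ?_⟩
  simp only [LinearMap.coe_sum, Finset.sum_apply, LinearMap.comp_apply, LinearMap.proj_apply,
    LinearMap.single_apply, ← map_sum, Finset.univ_sum_single]
  exact LinearMap.congr_fun hip q

theorem InAdd.homMap_injective (h : InAdd (Λ := Λ) P Q) :
    Function.Injective (homMap P : (Q →ₗ[Λ] N) → _) := by
  obtain ⟨n, a, b, hab⟩ := h.exists_dual_basis
  intro f g hfg
  have hexpand : ∀ f : Q →ₗ[Λ] N, f = ∑ k, homMap P f (a k) ∘ₗ b k := fun f ↦ by
    conv_lhs => rw [← LinearMap.comp_id f, ← hab]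
    ext; simp
  rw [hexpand f, hexpand g, hfg]

theorem InAdd.homMap_surjective (h : InAdd (Λ := Λ) P Q) :
    Function.Surjective (homMap P : (Q →ₗ[Λ] N) → _) := by
  obtain ⟨n, a, b, hab⟩ := h.exists_dual_basis
  intro g
  refine ⟨∑ k, g (a k) ∘ₗ b k, LinearMap.ext fun c ↦ ?_⟩
  have hexpand : c = ∑ k, (MulOpposite.op (b k ∘ₗ c) : Gam Λ P) • a k := by
    conv_lhs => rw [← LinearMap.id_comp c, ← hab]
    ext x
    simp [gam_smul_apply]
  conv_rhs => rw [hexpand, map_sum]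
  ext x
  simp [gam_smul_apply]

theorem HasAddPresentation.homMap_injective (h : HasAddPresentation Λ P 1 M) :
    Function.Injective (homMap P : (M →ₗ[Λ] N) → _) := by
  obtain ⟨Q, f, hf, hQ, -⟩ := h
  intro a b hab
  rw [← LinearMap.cancel_right hf]
  apply hQ.homMap_injective
  rw [homMap_comp, homMap_comp, hab]

theorem HasAddPresentation.subsingleton_hom_iff (h : HasAddPresentation Λ P 1 M) :
    Subsingleton (P →ₗ[Λ] M) ↔ Subsingleton M := by
  refine ⟨fun _ ↦ ?_, fun _ ↦ ⟨fun a b ↦ LinearMap.ext fun x ↦ Subsingleton.elim _ _⟩⟩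
  have hid : (LinearMap.id : M →ₗ[Λ] M) = 0 := h.homMap_injective (Subsingleton.elim _ _)
  exact subsingleton_of_forall_eq 0 (LinearMap.congr_fun hid)

theorem exists_comp_eq_of_exact {f : L →ₗ[Λ] M} {g : M →ₗ[Λ] N} (hfg : Function.Exact f g)
    (hg : Function.Surjective g) {b : M →ₗ[Λ] Q} (hb : b ∘ₗ f = 0) :
    ∃ c : N →ₗ[Λ] Q, c ∘ₗ g = b :=
  ⟨(LinearMap.range f).liftQ b (LinearMap.range_le_ker_iff.2 hb) ∘ₗ
    (hfg.linearEquivOfSurjective hg).symm.toLinearMap, LinearMap.ext fun x ↦ by simp⟩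

theorem isIndecomposable_congr_of_end {Λ' M' : Type u} [Ring Λ'] [AddCommGroup M'] [Module Λ' M']
    (e : Module.End Λ M ≃+* Module.End Λ' M') :
    IsIndecomposable (Λ := Λ) M ↔ IsIndecomposable (Λ := Λ') M' := by
  rw [isIndecomposable_iff_isIdempotentElem_end, isIndecomposable_iff_isIdempotentElem_end]
  refine and_congr e.toEquiv.nontrivial_congr (e.toEquiv.forall_congr fun a ↦ ?_)
  refine imp_congr ?_ (or_congr (map_eq_zero_iff e e.injective).symm
    (map_eq_one_iff e e.injective).symm)
  rw [IsIdempotentElem, IsIdempotentElem, ← e.injective.eq_iff, map_mul]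
  rfl

variable [Module.Projective Λ P]

theorem homMap_surjective {f : M →ₗ[Λ] N} (hf : Function.Surjective f) :
    Function.Surjective (homMap P f) := fun a ↦
  Module.projective_lifting_property f a hf

theorem homMap_exact {f : L →ₗ[Λ] M} {g : M →ₗ[Λ] N} (hfg : Function.Exact f g) :
    Function.Exact (homMap P f) (homMap P g) := by
  refine fun b ↦ ⟨fun hb ↦ ?_, ?_⟩
  · obtain ⟨c, hc⟩ := Module.projective_lifting_property f.rangeRestrict
      (b.codRestrict _ fun x ↦ (hfg _).1 (LinearMap.congr_fun hb x)) f.surjective_rangeRestrict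
    exact ⟨c, LinearMap.ext fun x ↦ congrArg Subtype.val (LinearMap.congr_fun hc x)⟩
  · rintro ⟨a, rfl⟩
    exact LinearMap.ext fun x ↦ hfg.apply_apply_eq_zero (a x)

theorem HasAddPresentation.homMap_surjective (h : HasAddPresentation Λ P 2 M) :
    Function.Surjective (homMap P : (M →ₗ[Λ] N) → _) := by
  obtain ⟨Q, f, hf, hQ, Q', f', hf', hQ', -⟩ := h
  have hexact : Function.Exact ((LinearMap.ker f).subtype ∘ₗ f') f :=
    hf'.comp_exact_iff_exact.2 f.exact_subtype_ker_map
  intro g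
  obtain ⟨b, hb⟩ := hQ.homMap_surjective (g ∘ₗ homMap P f)
  have hb0 : b ∘ₗ (LinearMap.ker f).subtype ∘ₗ f' = 0 := by
    apply hQ'.homMap_injective
    rw [homMap_comp, hb, LinearMap.comp_assoc, ← homMap_comp, hexact.linearMap_comp_eq_zero]
    ext; simp
  obtain ⟨c, hc⟩ := exists_comp_eq_of_exact hexact hf hb0
  refine ⟨c, ?_⟩
  rw [← LinearMap.cancel_right (IgusaTodorov.homMap_surjective (P := P) hf), ← homMap_comp, hc, hb]

theorem HasAddPresentation.nonempty_equiv (hM : HasAddPresentation Λ P 2 M)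
    (hN : HasAddPresentation Λ P 2 N) (e : (P →ₗ[Λ] M) ≃ₗ[Gam Λ P] (P →ₗ[Λ] N)) :
    Nonempty (M ≃ₗ[Λ] N) := by
  obtain ⟨f, hf⟩ := hM.homMap_surjective e.toLinearMap
  obtain ⟨g, hg⟩ := hN.homMap_surjective e.symm.toLinearMap
  refine ⟨LinearEquiv.ofLinearMap f g ?_ ?_⟩
  · apply hN.of_succ.homMap_injective
    rw [homMap_comp, hf, hg, homMap_id, LinearEquiv.comp_symm]
  · apply hM.of_succ.homMap_injective
    rw [homMap_comp, hf, hg, homMap_id, LinearEquiv.symm_comp]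

theorem HasAddPresentation.isSummand_of_hom (hM : HasAddPresentation Λ P 2 M)
    (hN : HasAddPresentation Λ P 2 N) (h : IsSummand (Λ := Gam Λ P) (P →ₗ[Λ] M) (P →ₗ[Λ] N)) :
    IsSummand (Λ := Λ) M N := by
  obtain ⟨i, p, hip⟩ := h
  obtain ⟨f, rfl⟩ := hM.homMap_surjective i
  obtain ⟨g, rfl⟩ := hN.homMap_surjective p
  exact ⟨f, g, hM.of_succ.homMap_injective hip⟩

theorem HasAddPresentation.inAdd_of_hom (hM : HasAddPresentation Λ P 2 M)
    (hN : HasAddPresentation Λ P 2 N) (h : InAdd (Λ := Gam Λ P) (P →ₗ[Λ] N) (P →ₗ[Λ] M)) :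
    InAdd (Λ := Λ) N M := by
  obtain ⟨n, hn⟩ := h
  exact ⟨n, hM.isSummand_of_hom (hN.pi n) (hn.trans (IsSummand.of_equiv (homPiEquiv P n).symm))⟩

/-- `Hom_Λ(P, -)` on endomorphism rings. -/
def HasAddPresentation.endEquiv (hM : HasAddPresentation Λ P 2 M) :
    Module.End Λ M ≃+* Module.End (Gam Λ P) (P →ₗ[Λ] M) :=
  RingEquiv.ofBijective
    ({  toFun := homMap P
        map_one' := rfl
        map_mul' := fun _ _ ↦ rfl
        map_zero' := LinearMap.ext fun a ↦ LinearMap.zero_comp a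
        map_add' := fun f g ↦ LinearMap.ext fun a ↦ LinearMap.add_comp a g f } :
      Module.End Λ M →+* Module.End (Gam Λ P) (P →ₗ[Λ] M))
    ⟨hM.of_succ.homMap_injective, hM.homMap_surjective⟩

theorem HasAddPresentation.isIndecomposable_hom_iff (hM : HasAddPresentation Λ P 2 M) :
    IsIndecomposable (Λ := Gam Λ P) (P →ₗ[Λ] M) ↔ IsIndecomposable (Λ := Λ) M :=
  (isIndecomposable_congr_of_end hM.endEquiv).symm

theorem exists_hom_equiv (A : Type u) [AddCommGroup A] [Module (Gam Λ P) A]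
    [Module.FinitePresentation (Gam Λ P) A] :
    ∃ M : ModuleCat.{u} Λ, HasAddPresentation Λ P 2 M ∧
      Nonempty ((P →ₗ[Λ] M) ≃ₗ[Gam Λ P] A) := by
  obtain ⟨n, m, f, g, hf, hgf⟩ := Module.FinitePresentation.exists_fin' (Gam Λ P) A
  obtain ⟨h, hh⟩ := (InAdd.pi_self P m).homMap_surjective
    ((homPiSelfEquiv P n).symm.toLinearMap ∘ₗ g ∘ₗ (homPiSelfEquiv P m).toLinearMap)
  have hexact : Function.Exact h (LinearMap.range h).mkQ := LinearMap.exact_map_mkQ_range h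
  have hsurj : Function.Surjective (LinearMap.range h).mkQ := Submodule.mkQ_surjective _
  have hexact_f : Function.Exact (homMap P h) (f ∘ₗ (homPiSelfEquiv P n).toLinearMap) := by
    rw [hh]
    exact (LinearEquiv.conj_symm_exact_iff_exact _ _ _).2
      (LinearEquiv.precomp_exact_iff_exact.2 hgf)
  refine ⟨ModuleCat.of Λ ((Fin n → P) ⧸ LinearMap.range h), ?_, ⟨?_⟩⟩
  · exact ⟨ModuleCat.of Λ (Fin n → P), _, hsurj, InAdd.pi_self P n,
      HasAddPresentation.ker_of_exact hexact (InAdd.pi_self P m) trivial⟩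
  · exact ((homMap_exact hexact).linearEquivOfSurjective (homMap_surjective hsurj)).symm ≪≫ₗ
      hexact_f.linearEquivOfSurjective (hf.comp (homPiSelfEquiv P n).surjective)

theorem IsProjectiveCover.homMap {π : Q →ₗ[Λ] M} (hπ : IsProjectiveCover π)
    (hQ : InAdd (Λ := Λ) P Q) : IsProjectiveCover (homMap P π) where
  projective := hQ.projective_hom
  surjective := homMap_surjective hπ.surjective
  superfluous N hN := by
    have hsurj : Function.Surjective (IgusaTodorov.homMap P π ∘ₗ N.subtype) := by
      rw [← LinearMap.range_eq_top, LinearMap.range_comp, Submodule.range_subtype]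
      exact (LinearMap.map_eq_top_iff
        (LinearMap.range_eq_top.2 (homMap_surjective hπ.surjective))).2 hN
    have := hQ.projective_hom
    obtain ⟨s, hs⟩ := Module.projective_lifting_property _ (IgusaTodorov.homMap P π) hsurj
    obtain ⟨a, ha⟩ := hQ.homMap_surjective (N.subtype ∘ₗ s)
    have hπa : π ∘ₗ a = π := by
      apply hQ.homMap_injective
      rw [homMap_comp, ha, ← LinearMap.comp_assoc, hs]
    have ha_surj : Function.Surjective (IgusaTodorov.homMap P a) :=
      homMap_surjective (hπ.surjective_of_comp (by rw [hπa]; exact hπ.surjective))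
    rw [eq_top_iff, ← LinearMap.range_eq_top.2 ha_surj, ha]
    exact (LinearMap.range_comp_le_range s N.subtype).trans N.range_subtype.le

end Hom

/-! ### The equivalence between modules presented by `add P` and `mod Γ` -/

section Coevaluation

variable (Λ : Type u) [Ring Λ] [IsArtinAlgebra Λ]
  (P : Type u) [AddCommGroup P] [Module Λ P] [Module.Finite Λ P]

/-- The evaluation functor `Hom_Λ(P, -) : mod Λ ⥤ mod Γ`. -/
def evalFunctorMod : FGModuleCat.{u} Λ ⥤ FGModuleCat.{u} (Gam Λ P) where
  obj := evalObj Λ P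
  map f := FGModuleCat.ofHom (homMap P f.hom.hom)

/-- The full subcategory `ℙ_1` of `mod Λ` of the modules presented by `add P`. -/
abbrev PresentedMod : Type (u + 1) :=
  ObjectProperty.FullSubcategory fun M : FGModuleCat.{u} Λ ↦ HasAddPresentation Λ P 2 M

/-- The restriction of the evaluation functor to the modules presented by `add P`. -/
def presentedEval : PresentedMod Λ P ⥤ FGModuleCat.{u} (Gam Λ P) :=
  ObjectProperty.ι _ ⋙ evalFunctorMod Λ P

instance : (presentedEval Λ P).Faithful where
  map_injective {M _} _ _ h := ObjectProperty.hom_ext _ <| FGModuleCat.hom_ext <|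
    M.property.of_succ.homMap_injective (congrArg (fun g ↦ g.hom.hom) h)

variable [Module.Projective Λ P]

instance : (presentedEval Λ P).Full where
  map_surjective {M _} g := by
    obtain ⟨f, hf⟩ := M.property.homMap_surjective g.hom.hom
    exact ⟨ObjectProperty.homMk (FGModuleCat.ofHom f), FGModuleCat.hom_ext hf⟩

instance : (presentedEval Λ P).EssSurj where
  mem_essImage A := by
    have : Module.FinitePresentation (Gam Λ P) A := Module.finitePresentation_of_finite _ _
    obtain ⟨M, hM, ⟨e⟩⟩ := exists_hom_equiv (Λ := Λ) (P := P) A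
    have := hM.finite
    exact ⟨⟨FGModuleCat.of Λ M, hM⟩, ⟨LinearEquiv.toFGModuleCatIso e⟩⟩

instance : (presentedEval Λ P).IsEquivalence where

/-- The coevaluation functor `mod Γ ⥤ mod Λ`, which sends a `Γ`-module `A` to the module presented
by `add P` whose evaluation is `A`; explicitly, it is `P ⊗_Γ -`. -/
def coevalFunctor : FGModuleCat.{u} (Gam Λ P) ⥤ FGModuleCat.{u} Λ :=
  (presentedEval Λ P).inv ⋙ ObjectProperty.ι _

/-- The coevaluation functor is a section of the evaluation functor. -/
def coevalEvalIso : coevalFunctor Λ P ⋙ evalFunctorMod Λ P ≅ 𝟭 (FGModuleCat.{u} (Gam Λ P)) :=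
  (presentedEval Λ P).asEquivalence.counitIso

variable {Λ}

/-- The module presented by `add P` whose evaluation is the `Γ`-module `A`. -/
abbrev coevalObj (A : FGModuleCat.{u} (Gam Λ P)) : FGModuleCat.{u} Λ :=
  (coevalFunctor Λ P).obj A

theorem hasAddPresentation_coevalObj (A : FGModuleCat.{u} (Gam Λ P)) :
    HasAddPresentation Λ P 2 (coevalObj P A) :=
  ((presentedEval Λ P).inv.obj A).property

/-- The evaluation of the coevaluation of a module is the module itself. -/
def evalCoevalEquiv (A : FGModuleCat.{u} (Gam Λ P)) :
    evalObj Λ P (coevalObj P A) ≃ₗ[Gam Λ P] A :=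
  FGModuleCat.isoToLinearEquiv ((coevalEvalIso Λ P).app A)

variable {P}

theorem subsingleton_of_coevalObj (A : FGModuleCat.{u} (Gam Λ P)) [Subsingleton (coevalObj P A)] :
    Subsingleton A :=
  have : Subsingleton (P →ₗ[Λ] coevalObj P A) :=
    (hasAddPresentation_coevalObj P A).of_succ.subsingleton_hom_iff.2 inferInstance
  Function.Injective.subsingleton (β := P →ₗ[Λ] coevalObj P A)
    (evalCoevalEquiv P A).symm.injective

theorem isIndecomposable_coevalObj_iff (A : FGModuleCat.{u} (Gam Λ P)) :
    IsIndecomposable (Λ := Λ) (coevalObj P A) ↔ IsIndecomposable (Λ := Gam Λ P) A :=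
  (hasAddPresentation_coevalObj P A).isIndecomposable_hom_iff.symm.trans
    (isIndecomposable_congr_of_end (evalCoevalEquiv P A).conjRingEquiv)

theorem HasAddPresentation.projective_hom_iff {M : Type u} [AddCommGroup M] [Module Λ M]
    (hM : HasAddPresentation Λ P 2 M) :
    Module.Projective (Gam Λ P) (P →ₗ[Λ] M) ↔ Module.Projective Λ M := by
  refine ⟨fun _ ↦ ?_, fun _ ↦ ?_⟩
  · have := hM.finite
    have hself : InAdd (Λ := Gam Λ P) (P →ₗ[Λ] P) (Gam Λ P) :=
      .of_isSummand (.of_equiv (homSelfEquiv P).symm) (InAdd.self _)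
    exact (hM.inAdd_of_hom ((InAdd.self P).isAddResolved 2)
      (InAdd.of_projective.trans hself)).projective
  · exact (hM.of_succ.inAdd_of_isSummand_of_projective
      (.of_equiv (LinearEquiv.refl Λ M))).projective_hom

variable {M : FGModuleCat.{u} Λ} {A : FGModuleCat.{u} (Gam Λ P)}

theorem HasAddPresentation.coevalObj_isSummand (hM : HasAddPresentation Λ P 2 M)
    (h : IsSummand (Λ := Gam Λ P) A (evalObj Λ P M)) : IsSummand (Λ := Λ) (coevalObj P A) M :=
  (hasAddPresentation_coevalObj P A).isSummand_of_hom hM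
    ((IsSummand.of_equiv (evalCoevalEquiv P A)).trans h)

theorem HasAddPresentation.inAdd_coevalObj (hM : HasAddPresentation Λ P 2 M)
    (h : InAdd (Λ := Gam Λ P) (evalObj Λ P M) A) : InAdd (Λ := Λ) M (coevalObj P A) :=
  (hasAddPresentation_coevalObj P A).inAdd_of_hom hM
    (.of_isSummand (.of_equiv (evalCoevalEquiv P A)) h)

end Coevaluation

/-! ### Comparison of `φ_l` -/

section StableEquiv

variable {Λ : Type u} [Ring Λ] {M N Q Q' R : Type u} [AddCommGroup M] [Module Λ M] [AddCommGroup N]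
  [Module Λ N] [AddCommGroup Q] [Module Λ Q] [AddCommGroup Q'] [Module Λ Q'] [AddCommGroup R]
  [Module Λ R]

theorem exists_split_of_prod_equiv (e : (M × Q) ≃ₗ[Λ] N × Q') [Module.Projective Λ Q']
    {π : R →ₗ[Λ] M} (hπ : Function.Surjective π) :
    ∃ (i : M →ₗ[Λ] N × R) (p : N × R →ₗ[Λ] M), p ∘ₗ i = LinearMap.id := by
  let f : M →ₗ[Λ] N × Q' := e.toLinearMap ∘ₗ LinearMap.inl Λ M Q
  let g : N × Q' →ₗ[Λ] M := LinearMap.fst Λ M Q ∘ₗ e.symm.toLinearMap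
  have hgf : g ∘ₗ f = LinearMap.id := by ext; simp [f, g]
  obtain ⟨c, hc⟩ := Module.projective_lifting_property π (g ∘ₗ LinearMap.inr Λ N Q') hπ
  refine ⟨LinearMap.id.prodMap c ∘ₗ f, (g ∘ₗ LinearMap.inl Λ N Q').coprod π, ?_⟩
  have hg : (g ∘ₗ LinearMap.inl Λ N Q').coprod π ∘ₗ LinearMap.id.prodMap c = g :=
    LinearMap.prod_ext (by ext; simp) (by rw [← hc]; ext; simp [Prod.mk_zero_zero])
  rw [← LinearMap.comp_assoc, hg, hgf]

theorem projective_ker_of_prod_equiv [IsNoetherian Λ M] [IsArtinian Λ M]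
    [Module.Projective Λ Q] [Module.Projective Λ R] (e : (M × Q) ≃ₗ[Λ] N × Q')
    {i : M →ₗ[Λ] N × R} {p : N × R →ₗ[Λ] M} (hpi : p ∘ₗ i = LinearMap.id) :
    Module.Projective Λ (LinearMap.ker p) := by
  have e' : ((Q × R) × M) ≃ₗ[Λ] (LinearMap.ker p × Q') × M :=
    prodRightComm Q R M ≪≫ₗ
      ((LinearEquiv.prodComm Λ Q M ≪≫ₗ e).prodCongr (LinearEquiv.refl Λ R)) ≪≫ₗ
      prodRightComm N Q' R ≪≫ₗ
      ((equivKerProd hpi).prodCongr (LinearEquiv.refl Λ Q')) ≪≫ₗ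
      prodRightComm (LinearMap.ker p) M Q'
  obtain ⟨σ⟩ := nonempty_equiv_of_prod_equiv e'
  have hker : IsSummand (Λ := Λ) (LinearMap.ker p) (LinearMap.ker p × Q') :=
    ⟨LinearMap.inl Λ _ _, LinearMap.fst Λ _ _, LinearMap.fst_comp_inl Λ _ _⟩
  exact (hker.trans (IsSummand.of_equiv σ.symm)).projective

end StableEquiv

section Phi

variable {Λ : Type u} [Ring Λ] [IsArtinAlgebra Λ]
  {P : Type u} [AddCommGroup P] [Module Λ P] [Module.Finite Λ P]

theorem IsStablyEquiv.cls_evalObj_eq {M N : FGModuleCat.{u} Λ} (h : IsStablyEquiv M N)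
    (hM : HasAddPresentation Λ P 1 M) (hN : HasAddPresentation Λ P 1 N)
    [Module.Projective Λ P] : K0.cls (evalObj Λ P M) = K0.cls (evalObj Λ P N) := by
  obtain ⟨Q, Q', hQ, hQ', ⟨e⟩⟩ := h
  obtain ⟨R, π, hπ, hR, -⟩ := hM
  have := hR.projective
  have := hR.finite
  obtain ⟨i, p, hpi⟩ := exists_split_of_prod_equiv e hπ
  have := projective_ker_of_prod_equiv e hpi
  have hsummand : IsSummand (Λ := Λ) (LinearMap.ker p) (N × R) :=
    IsSummand.trans ⟨LinearMap.inl Λ _ M, LinearMap.fst Λ _ M, LinearMap.fst_comp_inl Λ _ _⟩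
      (.of_equiv (equivKerProd hpi).symm)
  have hK : InAdd (Λ := Λ) P (LinearMap.ker p) :=
    (hN.prod (hR.isAddResolved 1)).inAdd_of_isSummand_of_projective hsummand
  have := hsummand.finite
  exact K0.cls_prod_projective (Q := evalObj Λ P (FGModuleCat.of Λ (LinearMap.ker p)))
    (R := evalObj Λ P (FGModuleCat.of Λ R))
    ((homProdEquiv P).symm ≪≫ₗ
      homEquiv P (LinearEquiv.prodComm Λ M _ ≪≫ₗ (equivKerProd hpi).symm) ≪≫ₗ homProdEquiv P)
    hK.projective_hom hR.projective_hom

variable [Module.Projective Λ P]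

variable (P) in
/-- The homomorphism of `K_0` induced by the coevaluation functor. -/
def K0.coeval : K0 (Gam Λ P) →+ K0 Λ :=
  QuotientAddGroup.lift (AddSubgroup.closure (k0Relations (Gam Λ P)))
    (FreeAbelianGroup.lift fun A ↦ K0.cls (coevalObj P A)) <| by
    rw [AddSubgroup.closure_le]
    rintro x (⟨A, B, C, ⟨e⟩, rfl⟩ | ⟨Q, hQ, rfl⟩)
    · obtain ⟨e'⟩ := (hasAddPresentation_coevalObj P C).nonempty_equiv
        ((hasAddPresentation_coevalObj P A).prod (hasAddPresentation_coevalObj P B))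
        (evalCoevalEquiv P C ≪≫ₗ e ≪≫ₗ ((evalCoevalEquiv P A).prodCongr
          (evalCoevalEquiv P B)).symm ≪≫ₗ (homProdEquiv P).symm)
      simp [K0.cls_prod e']
    · have hproj : Module.Projective Λ (coevalObj P Q) :=
        (hasAddPresentation_coevalObj P Q).projective_hom_iff.1
          (Module.Projective.of_equiv (evalCoevalEquiv P Q).symm)
      simp [K0.cls_projective _ hproj]

theorem K0.coeval_cls (A : FGModuleCat.{u} (Gam Λ P)) :
    K0.coeval P (K0.cls A) = K0.cls (coevalObj P A) := by
  simp [K0.coeval, K0.cls]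

theorem HasAddPresentation.coeval_cls_evalObj {M : FGModuleCat.{u} Λ}
    (hM : HasAddPresentation Λ P 2 M) : K0.coeval P (K0.cls (evalObj Λ P M)) = K0.cls M := by
  rw [K0.coeval_cls]
  exact K0.cls_congr ((hasAddPresentation_coevalObj P _).nonempty_equiv hM
    (evalCoevalEquiv P (evalObj Λ P M))).some

theorem K0.coeval_injective : Function.Injective (K0.coeval (Λ := Λ) P) := by
  rw [injective_iff_map_eq_zero]
  intro x hx
  obtain ⟨A, B, rfl⟩ := K0.exists_eq_cls_sub_cls x
  rw [map_sub, sub_eq_zero, K0.coeval_cls, K0.coeval_cls] at hx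
  have h := (K0.isStablyEquiv_of_cls_eq hx).cls_evalObj_eq
    (hasAddPresentation_coevalObj P A).of_succ (hasAddPresentation_coevalObj P B).of_succ
  rw [sub_eq_zero, ← K0.cls_congr (evalCoevalEquiv P A), h, K0.cls_congr (evalCoevalEquiv P B)]

theorem HasAddPresentation.nonempty_syzygy_equiv {M : FGModuleCat.{u} Λ}
    (hM : HasAddPresentation Λ P 1 M) {A : FGModuleCat.{u} (Gam Λ P)}
    (e : evalObj Λ P M ≃ₗ[Gam Λ P] A) :
    Nonempty (evalObj Λ P (IgusaTodorov.syzygy M) ≃ₗ[Gam Λ P] IgusaTodorov.syzygy A) := by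
  obtain ⟨σ⟩ := ((isProjectiveCover_coverMap M).homMap hM.inAdd_coverObj).nonempty_ker_equiv
    (isProjectiveCover_coverMap A) e
  exact ⟨homKerEquiv P (coverMap M) ≪≫ₗ σ⟩

theorem IsAddResolved.nonempty_syzygyIter_equiv {M : FGModuleCat.{u} Λ}
    (hM : IsAddResolved Λ P M) {A : FGModuleCat.{u} (Gam Λ P)}
    (e : evalObj Λ P M ≃ₗ[Gam Λ P] A) (n : ℕ) :
    Nonempty (evalObj Λ P (IgusaTodorov.syzygyIter n M) ≃ₗ[Gam Λ P]
      IgusaTodorov.syzygyIter n A) := by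
  induction n generalizing M A with
  | zero => exact ⟨e⟩
  | succ _ ih => exact ih hM.syzygy ((hM 1).nonempty_syzygy_equiv e).some

theorem HasAddPresentation.omega_cls_evalObj {M : FGModuleCat.{u} Λ}
    (hM : HasAddPresentation Λ P 1 M) :
    omega (Gam Λ P) (K0.cls (evalObj Λ P M)) = K0.cls (evalObj Λ P (IgusaTodorov.syzygy M)) := by
  rw [omega_cls]
  exact (K0.cls_congr (hM.nonempty_syzygy_equiv (LinearEquiv.refl _ _)).some).symm

variable (P) in
/-- The subgroup of `K_0(Γ)` generated by the evaluations of the modules in `ℙ_∞`. The coevaluation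
commutes with `Ω` on it, but not on all of `K_0(Γ)`. -/
def resolvedSpan : AddSubgroup (K0 (Gam Λ P)) :=
  AddSubgroup.closure {x | ∃ M : FGModuleCat.{u} Λ, IsAddResolved Λ P M ∧
    x = K0.cls (evalObj Λ P M)}

theorem omega_mem_resolvedSpan {x : K0 (Gam Λ P)} (hx : x ∈ resolvedSpan P) :
    omega (Gam Λ P) x ∈ resolvedSpan P := by
  suffices h : resolvedSpan P ≤ (resolvedSpan P).comap (omega (Gam Λ P)) from h hx
  rw [resolvedSpan, AddSubgroup.closure_le]
  rintro _ ⟨M, hM, rfl⟩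
  exact AddSubgroup.subset_closure ⟨syzygy M, hM.syzygy, (hM 1).omega_cls_evalObj⟩

theorem coeval_omega {x : K0 (Gam Λ P)} (hx : x ∈ resolvedSpan P) :
    K0.coeval P (omega (Gam Λ P) x) = omega Λ (K0.coeval P x) := by
  suffices h : resolvedSpan P ≤ ((K0.coeval P).comp (omega (Gam Λ P))).eqLocus
      ((omega Λ).comp (K0.coeval P)) from h hx
  rw [resolvedSpan, AddSubgroup.closure_le]
  rintro _ ⟨M, hM, rfl⟩
  change K0.coeval P (omega (Gam Λ P) (K0.cls _)) = omega Λ (K0.coeval P (K0.cls _))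
  rw [(hM 1).omega_cls_evalObj, (hM.syzygy 2).coeval_cls_evalObj, (hM 2).coeval_cls_evalObj,
    omega_cls]

variable {Y : FGModuleCat.{u} Λ}

theorem IsAddResolved.addSpan_le (hY : IsAddResolved Λ P Y) :
    addSpan (evalObj Λ P Y) ≤ resolvedSpan P := by
  rw [addSpan, AddSubgroup.closure_le]
  rintro x ⟨A, hA, -, rfl⟩
  exact AddSubgroup.subset_closure ⟨coevalObj P A, hY.of_isSummand ((hY 2).coevalObj_isSummand hA),
    (K0.cls_congr (evalCoevalEquiv P A)).symm⟩

theorem HasAddPresentation.map_addSpan (hY : HasAddPresentation Λ P 2 Y) :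
    (addSpan (evalObj Λ P Y)).map (K0.coeval P) = addSpan Y := by
  rw [addSpan, addSpan, AddMonoidHom.map_closure]
  congr 1
  ext x
  constructor
  · rintro ⟨_, ⟨A, hA, hA', rfl⟩, rfl⟩
    exact ⟨coevalObj P A, hY.coevalObj_isSummand hA, (isIndecomposable_coevalObj_iff A).2 hA',
      K0.coeval_cls A⟩
  · rintro ⟨X, hX, hX', rfl⟩
    have hX2 := hY.of_isSummand hX
    exact ⟨_, ⟨evalObj Λ P X, hX.hom, hX2.isIndecomposable_hom_iff.2 hX', rfl⟩,
      hX2.coeval_cls_evalObj⟩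

theorem omegaSpan_succ {Λ : Type u} [Ring Λ] [IsArtinianRing Λ] (M : FGModuleCat.{u} Λ) (s : ℕ) :
    omegaSpan M (s + 1) = (omegaSpan M s).map (omega Λ) :=
  Function.iterate_succ_apply' _ _ _

theorem IsAddResolved.omegaSpan_le (hY : IsAddResolved Λ P Y) (s : ℕ) :
    omegaSpan (evalObj Λ P Y) s ≤ resolvedSpan P := by
  induction s with
  | zero => exact hY.addSpan_le
  | succ s ih =>
    rw [omegaSpan_succ]
    rintro _ ⟨x, hx, rfl⟩
    exact omega_mem_resolvedSpan (ih hx)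

theorem IsAddResolved.map_omegaSpan (hY : IsAddResolved Λ P Y) (s : ℕ) :
    (omegaSpan (evalObj Λ P Y) s).map (K0.coeval P) = omegaSpan Y s := by
  induction s with
  | zero => exact (hY 2).map_addSpan
  | succ s ih =>
    rw [omegaSpan_succ, omegaSpan_succ, ← ih, AddSubgroup.map_map, AddSubgroup.map_map]
    refine SetLike.coe_injective (Set.image_congr fun x hx ↦ ?_)
    exact coeval_omega (hY.omegaSpan_le s hx)

theorem bijOn_omegaSpan_iff {Λ : Type u} [Ring Λ] [IsArtinianRing Λ] (M : FGModuleCat.{u} Λ)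
    (s : ℕ) : Set.BijOn (omega Λ) (omegaSpan M s) (omegaSpan M (s + 1)) ↔
      Set.InjOn (omega Λ) (omegaSpan M s) := by
  rw [omegaSpan_succ, AddSubgroup.coe_map]
  exact ⟨Set.BijOn.injOn, Set.InjOn.bijOn_image⟩

theorem IsAddResolved.injOn_omegaSpan_iff (hY : IsAddResolved Λ P Y) (s : ℕ) :
    Set.InjOn (omega Λ) (omegaSpan Y s) ↔
      Set.InjOn (omega (Gam Λ P)) (omegaSpan (evalObj Λ P Y) s) := by
  have hcomm : Set.EqOn (omega Λ ∘ K0.coeval P) (K0.coeval P ∘ omega (Gam Λ P))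
      (omegaSpan (evalObj Λ P Y) s) := fun x hx ↦ (coeval_omega (hY.omegaSpan_le s hx)).symm
  rw [← hY.map_omegaSpan s, AddSubgroup.coe_map, ← K0.coeval_injective.injOn.comp_iff,
    hcomm.injOn_iff]
  exact ⟨.of_comp, K0.coeval_injective.comp_injOn⟩

theorem IsAddResolved.phi_eq (hY : IsAddResolved Λ P Y) : phi Y = phi (evalObj Λ P Y) := by
  simp only [phi, bijOn_omegaSpan_iff, hY.injOn_omegaSpan_iff]

end Phi

/-! ### Comparison of `Ext` -/

section EvaluationFunctor

variable (Λ : Type u) [Ring Λ] (P : Type u) [AddCommGroup P] [Module Λ P]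

/-- The evaluation functor `Hom_Λ(P, -) : Mod Λ ⥤ Mod Γ` on all modules. -/
def evalFunctor : ModuleCat.{u} Λ ⥤ ModuleCat.{u} (Gam Λ P) where
  obj M := ModuleCat.of (Gam Λ P) (P →ₗ[Λ] M)
  map f := ModuleCat.ofHom (homMap P f.hom)

instance : (evalFunctor Λ P).Additive where
  map_add := rfl

variable [Module.Projective Λ P]

theorem shortExact_map_evalFunctor (S : ShortComplex (ModuleCat.{u} Λ)) (hS : S.ShortExact) :
    (S.map (evalFunctor Λ P)).ShortExact :=
  ModuleCat.shortComplex_shortExact _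
    (homMap_exact ((ShortComplex.ShortExact.moduleCat_exact_iff_function_exact S).1 hS.exact))
    (homMap_injective hS.moduleCat_injective_f) (homMap_surjective hS.moduleCat_surjective_g)

instance : Limits.PreservesFiniteLimits (evalFunctor Λ P) :=
  (((evalFunctor Λ P).exact_tfae.out 0 3 rfl rfl).1 (shortExact_map_evalFunctor Λ P)).1

instance : Limits.PreservesFiniteColimits (evalFunctor Λ P) :=
  (((evalFunctor Λ P).exact_tfae.out 0 3 rfl rfl).1 (shortExact_map_evalFunctor Λ P)).2

variable {Λ P}

theorem HasAddPresentation.bijective_map_evalFunctor {X : ModuleCat.{u} Λ}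
    (hX : HasAddPresentation Λ P 2 X) (N : ModuleCat.{u} Λ) :
    Function.Bijective ((evalFunctor Λ P).map (X := X) (Y := N)) := by
  refine ⟨fun f g hfg ↦ ?_, fun g ↦ ?_⟩
  · exact ModuleCat.hom_ext (hX.of_succ.homMap_injective (congrArg ModuleCat.Hom.hom hfg))
  · obtain ⟨f, hf⟩ := hX.homMap_surjective g.hom
    exact ⟨ModuleCat.ofHom f, ModuleCat.hom_ext hf⟩

attribute [local simp] Abelian.Ext.mapExactFunctor_comp Abelian.Ext.mapExactFunctor_mk₀
  Abelian.Ext.mapExactFunctor_extClass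

attribute [local instance] Abelian.Ext.subsingleton_of_projective

open Abelian in
/-- Dimension shifting: both rows of the map of long exact `Ext` sequences end in `0`. -/
theorem bijective_mapExtAddHom_succ {S : ShortComplex (ModuleCat.{u} Λ)} (hS : S.ShortExact)
    (hQ : InAdd (Λ := Λ) P S.X₂) {N : ModuleCat.{u} Λ} {d : ℕ}
    (h₁ : Function.Bijective ((evalFunctor Λ P).mapExtAddHom S.X₁ N d))
    (h₂ : Function.Surjective ((evalFunctor Λ P).mapExtAddHom S.X₂ N d)) :
    Function.Bijective ((evalFunctor Λ P).mapExtAddHom S.X₃ N (d + 1)) := by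
  have hS' := shortExact_map_evalFunctor Λ P S hS
  have hX₂ : Projective S.X₂ := (IsProjective.iff_projective _).1 hQ.projective
  have hX₂' : Projective (S.map (evalFunctor Λ P)).X₂ :=
    (IsProjective.iff_projective (P →ₗ[Λ] S.X₂)).1 hQ.projective_hom
  exact AddMonoidHom.bijective_of_surjective_of_bijective_of_right_exact _ _ _ _
    ((evalFunctor Λ P).mapExtAddHom S.X₂ N d) ((evalFunctor Λ P).mapExtAddHom S.X₁ N d)
    ((evalFunctor Λ P).mapExtAddHom S.X₃ N (d + 1))
    (by cat_disch) (by cat_disch)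
    ((ShortComplex.ab_exact_iff_function_exact _).1
      (Ext.contravariant_sequence_exact₁' hS N d (d + 1) (add_comm 1 d)))
    ((ShortComplex.ab_exact_iff_function_exact _).1
      (Ext.contravariant_sequence_exact₁' hS' ((evalFunctor Λ P).obj N) d (d + 1)
        (add_comm 1 d)))
    h₂ h₁
    (fun x₃ ↦ Ext.contravariant_sequence_exact₃ hS _ x₃ (by subsingleton) (add_comm 1 d))
    (fun y₃ ↦ Ext.contravariant_sequence_exact₃ hS' _ y₃ (by subsingleton) (add_comm 1 d))

theorem HasAddPresentation.bijective_mapExtAddHom {d : ℕ} {X : ModuleCat.{u} Λ}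
    (hX : HasAddPresentation Λ P (d + 2) X) (N : ModuleCat.{u} Λ) :
    Function.Bijective ((evalFunctor Λ P).mapExtAddHom X N d) := by
  induction d generalizing X with
  | zero => simpa [Abelian.Ext.mapExactFunctor₀] using hX.bijective_map_evalFunctor N
  | succ d ih =>
    obtain ⟨Q, f, hf, hQ, hK⟩ := hX
    exact bijective_mapExtAddHom_succ (S := f.shortComplexKer)
      (LinearMap.shortExact_shortComplexKer hf) hQ (ih hK)
      (ih (hQ.isAddResolved (d + 2))).surjective

end EvaluationFunctor

section ExtComparison

variable {Λ : Type u} [Ring Λ] [IsArtinAlgebra Λ]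
  {P : Type u} [AddCommGroup P] [Module Λ P] [Module.Finite Λ P] [Module.Projective Λ P]

/-- The natural isomorphism `Ext^d_Λ(X, -) ≃ Ext^d_Γ(Hom_Λ(P, X), Hom_Λ(P, -))` induced by the
evaluation functor. -/
def HasAddPresentation.extIso {d : ℕ} {X : FGModuleCat.{u} Λ}
    (hX : HasAddPresentation Λ P (d + 2) X) :
    extFunctorMod X d ≅ evalFunctorMod Λ P ⋙ extFunctorMod (evalObj Λ P X) d :=
  NatIso.ofComponents (fun N ↦ AddEquiv.toAddCommGrpIso
    (AddEquiv.ofBijective ((evalFunctor Λ P).mapExtAddHom X.obj N.obj d)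
      (hX.bijective_mapExtAddHom N.obj))) <| by
    intro N N' f
    ext α
    have h := Abelian.Ext.mapExactFunctor_comp (evalFunctor Λ P) (α : Abelian.Ext X.obj N.obj d)
      (Abelian.Ext.mk₀ f.hom) (add_zero d)
    rw [Abelian.Ext.mapExactFunctor_mk₀] at h
    exact h

/-- The natural isomorphism `Ext^d_Γ(Hom_Λ(P, X), -) ≃ Ext^d_Λ(X, P ⊗_Γ -)`, where `P ⊗_Γ -` stands
for `coevalFunctor`. -/
def HasAddPresentation.coevalExtIso {d : ℕ} {X : FGModuleCat.{u} Λ}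
    (hX : HasAddPresentation Λ P (d + 2) X) :
    extFunctorMod (evalObj Λ P X) d ≅ coevalFunctor Λ P ⋙ extFunctorMod X d :=
  (Functor.leftUnitor _).symm ≪≫ Functor.isoWhiskerRight (coevalEvalIso Λ P).symm _ ≪≫
    Functor.associator _ _ _ ≪≫ Functor.isoWhiskerLeft (coevalFunctor Λ P) hX.extIso.symm

theorem HasAddPresentation.nonempty_ext_iso_iff {d : ℕ} {X X' : FGModuleCat.{u} Λ}
    (hX : HasAddPresentation Λ P (d + 2) X) (hX' : HasAddPresentation Λ P (d + 2) X') :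
    Nonempty (extFunctorMod X d ≅ extFunctorMod X' d) ↔
      Nonempty (extFunctorMod (evalObj Λ P X) d ≅ extFunctorMod (evalObj Λ P X') d) where
  mp := fun ⟨i⟩ ↦ ⟨hX.coevalExtIso ≪≫ Functor.isoWhiskerLeft _ i ≪≫ hX'.coevalExtIso.symm⟩
  mpr := fun ⟨i⟩ ↦ ⟨hX.extIso ≪≫ Functor.isoWhiskerLeft _ i ≪≫ hX'.extIso.symm⟩

/-- `Ext^d(X, -)` depends only on the isomorphism class of `X`. -/
def extFunctorModIso {Λ : Type u} [Ring Λ] {X Y : FGModuleCat.{u} Λ} (e : X ≃ₗ[Λ] Y) (d : ℕ) :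
    extFunctorMod X d ≅ extFunctorMod Y d :=
  Functor.isoWhiskerLeft _
    ((Abelian.extFunctor d).mapIso (LinearEquiv.toModuleIso e).symm.op)

theorem IsDivision.of_equiv {Λ : Type u} [Ring Λ] {d : ℕ} {M X Y X' Y' : FGModuleCat.{u} Λ}
    (h : IsDivision d M X Y) (e : X ≃ₗ[Λ] X') (e' : Y ≃ₗ[Λ] Y') : IsDivision d M X' Y' where
  left_mem := h.left_mem.of_isSummand (.of_equiv e.symm)
  right_mem := h.right_mem.of_isSummand (.of_equiv e'.symm)
  add_inter Z hZ hZ' := h.add_inter Z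
    (hZ.trans ((InAdd.self _).of_isSummand (.of_equiv e.symm)))
    (hZ'.trans ((InAdd.self _).of_isSummand (.of_equiv e'.symm)))
  not_iso := fun ⟨i⟩ ↦ h.not_iso
    ⟨extFunctorModIso e d ≪≫ i ≪≫ (extFunctorModIso e' d).symm⟩
  iso_succ := h.iso_succ.map fun i ↦
    (extFunctorModIso e (d + 1)).symm ≪≫ i ≪≫ extFunctorModIso e' (d + 1)

variable {d : ℕ} {M X Y : FGModuleCat.{u} Λ}

theorem IsAddResolved.isDivision_evalObj (hM : IsAddResolved Λ P M) (h : IsDivision d M X Y) :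
    IsDivision d (evalObj Λ P M) (evalObj Λ P X) (evalObj Λ P Y) where
  left_mem := h.left_mem.hom
  right_mem := h.right_mem.hom
  add_inter Z hZ hZ' :=
    have := h.add_inter (coevalObj P Z) ((hM.of_inAdd h.left_mem 2).inAdd_coevalObj hZ)
      ((hM.of_inAdd h.right_mem 2).inAdd_coevalObj hZ')
    subsingleton_of_coevalObj Z
  not_iso := ((hM.of_inAdd h.left_mem _).nonempty_ext_iso_iff
    (hM.of_inAdd h.right_mem _)).not.1 h.not_iso
  iso_succ := ((hM.of_inAdd h.left_mem _).nonempty_ext_iso_iff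
    (hM.of_inAdd h.right_mem _)).1 h.iso_succ

theorem IsAddResolved.isDivision_of_evalObj (hM : IsAddResolved Λ P M)
    (hX : HasAddPresentation Λ P 2 X) (hY : HasAddPresentation Λ P 2 Y)
    (h : IsDivision d (evalObj Λ P M) (evalObj Λ P X) (evalObj Λ P Y)) : IsDivision d M X Y := by
  have hXM : InAdd (Λ := Λ) M X := hX.inAdd_of_hom (hM 2) h.left_mem
  have hYM : InAdd (Λ := Λ) M Y := hY.inAdd_of_hom (hM 2) h.right_mem
  exact {
    left_mem := hXM
    right_mem := hYM
    add_inter := fun Z hZ hZ' ↦ ((hM.of_inAdd hXM).of_inAdd hZ 1).subsingleton_hom_iff.1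
      (h.add_inter (evalObj Λ P Z) hZ.hom hZ'.hom)
    not_iso := ((hM.of_inAdd hXM _).nonempty_ext_iso_iff (hM.of_inAdd hYM _)).not.2 h.not_iso
    iso_succ := ((hM.of_inAdd hXM _).nonempty_ext_iso_iff (hM.of_inAdd hYM _)).2 h.iso_succ }

theorem IsAddResolved.hasDivision_iff (hM : IsAddResolved Λ P M) (d : ℕ) :
    HasDivision d M ↔ HasDivision d (evalObj Λ P M) where
  mp := fun ⟨X, Y, h⟩ ↦ ⟨evalObj Λ P X, evalObj Λ P Y, hM.isDivision_evalObj h⟩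
  mpr := fun ⟨A, B, h⟩ ↦ ⟨coevalObj P A, coevalObj P B,
    hM.isDivision_of_evalObj (hasAddPresentation_coevalObj P A) (hasAddPresentation_coevalObj P B)
      (h.of_equiv (evalCoevalEquiv P A).symm (evalCoevalEquiv P B).symm)⟩

end ExtComparison

/-! ### Comparison of `ψ_l` -/

section ProjectiveDimension

variable {Λ : Type u} [Ring Λ] [IsArtinAlgebra Λ]
  {P : Type u} [AddCommGroup P] [Module Λ P] [Module.Finite Λ P] [Module.Projective Λ P]
  {X Y : FGModuleCat.{u} Λ}

theorem HasAddPresentation.hasProjectiveDimensionLT_evalObj_iff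
    (hX : HasAddPresentation Λ P 1 X) (n : ℕ) :
    HasProjectiveDimensionLT (evalObj Λ P X).obj (n + 2) ↔
      HasProjectiveDimensionLT (evalObj Λ P (IgusaTodorov.syzygy X)).obj (n + 1) :=
  (shortExact_map_evalFunctor Λ P _ (LinearMap.shortExact_shortComplexKer
    (isProjectiveCover_coverMap X).surjective)).hasProjectiveDimensionLT_X₃_iff n
      ((IsProjective.iff_projective (P →ₗ[Λ] coverObj X)).1 hX.inAdd_coverObj.projective_hom)

theorem hasProjectiveDimensionLT_iff_syzygy (X : FGModuleCat.{u} Λ) (n : ℕ) :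
    HasProjectiveDimensionLT X.obj (n + 2) ↔ HasProjectiveDimensionLT (syzygy X).obj (n + 1) :=
  (LinearMap.shortExact_shortComplexKer
    (isProjectiveCover_coverMap X).surjective).hasProjectiveDimensionLT_X₃_iff n
      ((IsProjective.iff_projective (coverObj X)).1 (isProjectiveCover_coverMap X).projective)

theorem IsAddResolved.hasProjectiveDimensionLT_iff {X : FGModuleCat.{u} Λ}
    (hX : IsAddResolved Λ P X) (n : ℕ) :
    HasProjectiveDimensionLT X.obj n ↔ HasProjectiveDimensionLT (evalObj Λ P X).obj n := by
  match n with
  | 0 =>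
    rw [hasProjectiveDimensionLT_zero_iff_isZero, hasProjectiveDimensionLT_zero_iff_isZero,
      ModuleCat.isZero_iff_subsingleton, ModuleCat.isZero_iff_subsingleton]
    exact (hX 1).subsingleton_hom_iff.symm
  | 1 =>
    rw [← projective_iff_hasProjectiveDimensionLT_one,
      ← projective_iff_hasProjectiveDimensionLT_one, ← IsProjective.iff_projective,
      ← IsProjective.iff_projective]
    exact (hX 2).projective_hom_iff.symm
  | n + 2 =>
    rw [hasProjectiveDimensionLT_iff_syzygy, (hX 1).hasProjectiveDimensionLT_evalObj_iff]
    exact hX.syzygy.hasProjectiveDimensionLT_iff (n + 1)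

theorem IsAddResolved.projectiveDimension_eq (hX : IsAddResolved Λ P X) :
    projectiveDimension X.obj = projectiveDimension (evalObj Λ P X).obj := by
  simp only [projectiveDimension, hX.hasProjectiveDimensionLT_iff]

theorem IsAddResolved.psi_eq (hY : IsAddResolved Λ P Y) : psi Y = psi (evalObj Λ P Y) := by
  have hΩ := hY.syzygyIter (phi Y)
  obtain ⟨e⟩ := hY.nonempty_syzygyIter_equiv (LinearEquiv.refl _ (evalObj Λ P Y)) (phi Y)
  rw [psi, psi, ← hY.phi_eq]
  congr 2
  ext m
  constructor
  · rintro ⟨X, n, hX, hn, rfl⟩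
    exact ⟨evalObj Λ P X, n, hX.hom.trans (.of_equiv e),
      (hΩ.of_isSummand hX).projectiveDimension_eq.symm.trans hn, rfl⟩
  · rintro ⟨A, n, hA, hn, rfl⟩
    have hX := (hΩ 2).coevalObj_isSummand (hA.trans (.of_equiv e.symm))
    refine ⟨coevalObj P A, n, hX, ?_, rfl⟩
    rw [(hΩ.of_isSummand hX).projectiveDimension_eq, ← hn]
    exact projectiveDimension_eq_of_iso (LinearEquiv.toModuleIso (evalCoevalEquiv P A))

end ProjectiveDimension

end

end IgusaTodorov

theorem proposition4p5 {Λ : Type u} [Ring Λ] [IgusaTodorov.IsArtinAlgebra Λ]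
    (P : Type u) [AddCommGroup P] [Module Λ P] [Module.Finite Λ P] [Module.Projective Λ P]
    (Y : FGModuleCat.{u} Λ) (hY : IgusaTodorov.HasAddResolution P Y) :
    (∀ d : ℕ, IgusaTodorov.HasDivision d Y ↔
      IgusaTodorov.HasDivision d (IgusaTodorov.evalObj Λ P Y)) ∧
    IgusaTodorov.phi Y = IgusaTodorov.phi (IgusaTodorov.evalObj Λ P Y) ∧
    IgusaTodorov.psi Y = IgusaTodorov.psi (IgusaTodorov.evalObj Λ P Y) := by
  have h := hY.isAddResolved
  exact ⟨h.hasDivision_iff, h.phi_eq, h.psi_eq⟩
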